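/- Let $M$ be a smooth Riemannian manifold of dimension $m+1\ge 1$, and let $k,p\ge 0$ be integers with $2p\le k$. Then the Riemannian curvature measure $C^M_{kp}$ is angular. The notions are as follows; all tangent spaces are oriented, and a change of orientation affects none of the signed measures below. *The curvature measure $C^M_{kp}$.* Let $\pi: SM\to M$ be the unit sphere bundle. For $\xi\in S_xM$ let $b=(b_0=\xi,b_1,\dots,b_m)$ be a positively oriented orthonormal frame of $T_xM$ and let, for $v,w\in T_\xi SM$, $$\theta_i(v)=\langle d\pi(v),b_i\rangle,\qquad \omega_{i0}(v)=\langle K(v),b_i\rangle,\qquad \Omega_{ij}(v,w)=\langle R(d\pi(v),d\pi(w))b_j,b_i\rangle,$$ where $K:T_\xi TM\to T_xM$ is the connection map of the Levi-Civita connection and $R$ is its curvature tensor. If $k\le m$, let $$\phi_{kp}=\sum_{\tau}\operatorname{sgn}(\tau)\,\Omega_{\tau_1\tau_2}\cdots\Omega_{\tau_{2p-1}\tau_{2p}}\,\theta_{\tau_{2p+1}}\cdots\theta_{\tau_k}\,\omega_{\tau_{k+1}0}\cdots\omega_{\tau_m0}\in\Omega^m(SM),$$ the sum being over the permutations $\tau$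 of $\{1,\dots,m\}$; if $k=m+1$, let $$\psi_p=\sum_\tau\operatorname{sgn}(\tau)\,\Omega_{\tau_0\tau_1}\cdots\Omega_{\tau_{2p-2}\tau_{2p-1}}\,\theta_{\tau_{2p}}\cdots\theta_{\tau_m}\in\Omega^{m+1}(M),$$ the sum being over the permutations of $\{0,\dots,m\}$. These forms do not depend on the choice of the frame. (If $m=0$ and the only adapted frame $(\xi)$ is negatively oriented, the value at $\xi$ is multiplied by $-1$.) Write $[\psi,\phi]$ for the curvature measure determined by $\psi\in\Omega^m(SM)$ and $\phi\in\Omega^{m+1}(M)$, and let $\omega_j$ denote the volume of the unit ball of $\mathbb R^j$. Then $$C^M_{kp}=\begin{cases}\dfrac{\omega_k}{\pi^k\,(m+1-k)!\,\omega_{m+1-k}}\,[\phi_{kp},0], & k<m+1,\\[2mm] \dfrac{\omega_k}{\pi^k}\,[0,\psi_p], & k=m+1,\\[2mm] 0,& k>m+1.\end{cases}$$ *The associated section.* For $x\in M$ and $u\in S_xM$ the Levi-Civita connection gives an isomorphism $T_uSM\cong T_xM\oplus u^\perp$ (horizontal and vertical part), and $T_xM\oplus u^\perp$ is the tangent space of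 $T_xM\times S(T_xM)$ at every point $(y,u)$. Thus $\psi\in\Omega^m(SM)$ and $\phi\in\Omega^{m+1}(M)$ determine a translation-invariant $m$-form $\psi_x$ on $T_xM\times S(T_xM)$ and a translation-invariant $(m+1)$-form $\phi_x$ on $T_xM$. For a convex polytope $P\subset T_xM$ with normal cycle $N(P)$ (the unit normal bundle of $P$ in $T_xM\times S(T_xM)$, oriented by means of the outer parallel hypersurfaces of $P$) put $$\Psi_x(P,A)=\int_{N(P)\cap (A\times S(T_xM))}\psi_x+\int_{P\cap A}\phi_x,\qquad A\subset T_xM\ \text{Borel}.$$ *Angularity.* The curvature measure $[\psi,\phi]$ on $M$ is angular if for every $x\in M$ there is a real function $c$ on the set of all linear subspaces of $T_xM$ such that for every convex polytope $P\subset T_xM$ $$\Psi_x(P,\cdot)=\sum_{j=0}^{m+1}\ \sum_{F}\ c(\vec F)\,\angle(F,P)\,\mathcal H^j|_F,$$ where $F$ ranges over the $j$-dimensional faces of $P$, $\vec F$ is the linear subspace parallel to $F$, $\angle(F,P)$ is the exterior solid angle of $P$ along $F$, and $\mathcal H^j$ is the $j$-dimensional Hausdorff measure. -/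

import Mathlib

open scoped Manifold ContDiff Bundle MeasureTheory

set_option maxSynthPendingDepth 3

noncomputable section

namespace RiemCurv

/-! ### Wedge products of two-forms and one-forms -/

section Wedge

variable {W : Type*} [AddCommGroup W] [Module ℝ W]

open Classical in
/-- The slot `i`, with all other arguments fixed, as a linear map. -/
theorem tensorProd_linear {q p : ℕ} (h : 2 * p ≤ q) (A : Fin p → W →ₗ[ℝ] W →ₗ[ℝ] ℝ)
    (a : Fin q → W →ₗ[ℝ] ℝ) (v : Fin q → W) (i : Fin q) :
    ∃ L : W →ₗ[ℝ] ℝ, ∀ x : W,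
      (∏ j : Fin p, A j (Function.update v i x ⟨2 * j, by omega⟩)
        (Function.update v i x ⟨2 * j + 1, by omega⟩)) *
      (∏ l : Fin q, if (l : ℕ) < 2 * p then 1 else a l (Function.update v i x l)) = L x := by
  by_cases hi : (i : ℕ) < 2 * p
  · have h2 : ∀ x : W,
        (∏ l : Fin q, if (l : ℕ) < 2 * p then 1 else a l (Function.update v i x l)) =
          ∏ l : Fin q, if (l : ℕ) < 2 * p then 1 else a l (v l) := by
      intro x
      refine Finset.prod_congr rfl fun l _ => ?_
      by_cases hl : (l : ℕ) < 2 * p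
      · simp [hl]
      · have : l ≠ i := fun e => hl (e ▸ hi)
        simp [hl, this]
    set j₀ : Fin p := ⟨i / 2, by omega⟩ with hj₀
    have h1 : ∀ x : W, (∏ j ∈ Finset.univ.erase j₀, A j (Function.update v i x ⟨2 * j, by omega⟩)
        (Function.update v i x ⟨2 * j + 1, by omega⟩)) =
        ∏ j ∈ Finset.univ.erase j₀, A j (v ⟨2 * j, by omega⟩) (v ⟨2 * j + 1, by omega⟩) := by
      intro x
      refine Finset.prod_congr rfl fun j hj => ?_
      have hj' : (j : ℕ) ≠ i / 2 := fun e => (Finset.ne_of_mem_erase hj) (Fin.ext e)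
      have e1 : (⟨2 * j, by omega⟩ : Fin q) ≠ i := fun e => hj' (by rw [← e]; simp)
      have e2 : (⟨2 * j + 1, by omega⟩ : Fin q) ≠ i := fun e => hj' (by rw [← e]; simp; omega)
      rw [Function.update_of_ne e1, Function.update_of_ne e2]
    set C := (∏ j ∈ Finset.univ.erase j₀, A j (v ⟨2 * j, by omega⟩) (v ⟨2 * j + 1, by omega⟩)) *
      ∏ l : Fin q, if (l : ℕ) < 2 * p then 1 else a l (v l) with hC
    rcases Nat.mod_two_eq_zero_or_one (i : ℕ) with hm | hm
    · refine ⟨C • (A j₀).flip (v ⟨2 * j₀ + 1, by omega⟩), fun x => ?_⟩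
      have e1 : (⟨2 * j₀, by omega⟩ : Fin q) = i := Fin.ext (by simp [hj₀]; omega)
      have e2 : (⟨2 * j₀ + 1, by omega⟩ : Fin q) ≠ i := fun e => by
        have := congrArg Fin.val e; simp [hj₀] at this; omega
      rw [← Finset.mul_prod_erase _ _ (Finset.mem_univ j₀), h1, h2, Function.update_of_ne e2, e1,
        Function.update_self]
      simp [hC]; ring
    · refine ⟨C • (A j₀) (v ⟨2 * j₀, by omega⟩), fun x => ?_⟩
      have e1 : (⟨2 * j₀, by omega⟩ : Fin q) ≠ i := fun e => by
        have := congrArg Fin.val e; simp [hj₀] at this; omega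
      have e2 : (⟨2 * j₀ + 1, by omega⟩ : Fin q) = i := Fin.ext (by simp [hj₀]; omega)
      rw [← Finset.mul_prod_erase _ _ (Finset.mem_univ j₀), h1, h2, Function.update_of_ne e1, e2,
        Function.update_self]
      simp [hC]; ring
  · refine ⟨((∏ j : Fin p, A j (v ⟨2 * j, by omega⟩) (v ⟨2 * j + 1, by omega⟩)) *
      ∏ l ∈ Finset.univ.erase i, if (l : ℕ) < 2 * p then 1 else a l (v l)) • a i, fun x => ?_⟩
    have h1 : (∏ j : Fin p, A j (Function.update v i x ⟨2 * j, by omega⟩)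
        (Function.update v i x ⟨2 * j + 1, by omega⟩)) =
        ∏ j : Fin p, A j (v ⟨2 * j, by omega⟩) (v ⟨2 * j + 1, by omega⟩) := by
      refine Finset.prod_congr rfl fun j _ => ?_
      have e1 : (⟨2 * j, by omega⟩ : Fin q) ≠ i := fun e => hi (by rw [← e]; simp)
      have e2 : (⟨2 * j + 1, by omega⟩ : Fin q) ≠ i := fun e => hi (by rw [← e]; simp; omega)
      rw [Function.update_of_ne e1, Function.update_of_ne e2]
    have h2 : (∏ l ∈ Finset.univ.erase i,
        if (l : ℕ) < 2 * p then 1 else a l (Function.update v i x l)) =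
        ∏ l ∈ Finset.univ.erase i, if (l : ℕ) < 2 * p then 1 else a l (v l) := by
      refine Finset.prod_congr rfl fun l hl => ?_
      rw [Function.update_of_ne (Finset.ne_of_mem_erase hl)]
    rw [h1, ← Finset.mul_prod_erase _ _ (Finset.mem_univ i), h2]
    simp [hi]; ring

/-- The multilinear map
`v ↦ A₀(v₀, v₁) ⋯ A_{p-1}(v_{2p-2}, v_{2p-1}) a_{2p}(v_{2p}) ⋯ a_{q-1}(v_{q-1})`. -/
def tensorProd {q p : ℕ} (h : 2 * p ≤ q) (A : Fin p → W →ₗ[ℝ] W →ₗ[ℝ] ℝ)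
    (a : Fin q → W →ₗ[ℝ] ℝ) : MultilinearMap ℝ (fun _ : Fin q => W) ℝ :=
  MultilinearMap.mk'
    (fun v => (∏ j : Fin p, A j (v ⟨2 * j, by omega⟩) (v ⟨2 * j + 1, by omega⟩)) *
      ∏ i : Fin q, if (i : ℕ) < 2 * p then 1 else a i (v i))
    (by
      intro v i x y
      obtain ⟨L, hL⟩ := tensorProd_linear h A a v i
      rw [hL, hL, hL, map_add])
    (by
      intro v i c x
      obtain ⟨L, hL⟩ := tensorProd_linear h A a v i
      rw [hL, hL, map_smul])

/-- The wedge product `A₀ ∧ ⋯ ∧ A_{p-1} ∧ a_{2p} ∧ ⋯ ∧ a_{q-1}` of `p` two-forms (antisymmetric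
bilinear forms) and `q - 2p` one-forms, normalized so that
`(a ∧ b)(v, w) = a(v) b(w) - a(w) b(v)`. The entries `a_i` with `i < 2p` play no role. -/
def wedge {q p : ℕ} (h : 2 * p ≤ q) (A : Fin p → W →ₗ[ℝ] W →ₗ[ℝ] ℝ)
    (a : Fin q → W →ₗ[ℝ] ℝ) : W [⋀^Fin q]→ₗ[ℝ] ℝ :=
  ((2 : ℝ) ^ p)⁻¹ • MultilinearMap.alternatization (tensorProd h A a)

end Wedge

/-! ### Oriented orthonormal frames -/

section Frames

variable {V : Type*} [NormedAddCommGroup V] [InnerProductSpace ℝ V] {m : ℕ}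

open Classical in
/-- `1` if the frame is positively oriented, `-1` otherwise. -/
def frameSign (o : Orientation ℝ V (Fin (m + 1))) (b : OrthonormalBasis (Fin (m + 1)) ℝ V) : ℝ :=
  if b.toBasis.orientation = o then 1 else -1

open Classical in
/-- The common value of `T` on the positively oriented orthonormal frames `(b₀, …, b_m)`, for a
quantity `T` that is multiplied by `det g` when the frame is moved by `g`. -/
def frameValue {A : Type*} [AddCommGroup A] [Module ℝ A] (o : Orientation ℝ V (Fin (m + 1)))
    (T : OrthonormalBasis (Fin (m + 1)) ℝ V → A) : A :=
  if h : Nonempty (OrthonormalBasis (Fin (m + 1)) ℝ V) then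
    frameSign o h.some • T h.some else 0

open Classical in
/-- The common value of `T` on the positively oriented orthonormal frames adapted to the unit
vector `u`, i.e. with `b₀ = u`, for a quantity `T` that is multiplied by `det g` when
`(b₁, …, b_m)` is moved by `g ∈ O(m)`. The sign makes sense of this also for `m = 0`, where the
only adapted frame `(u)` may be negative. -/
def adaptedFrameValue {A : Type*} [AddCommGroup A] [Module ℝ A]
    (o : Orientation ℝ V (Fin (m + 1))) (u : V)
    (T : OrthonormalBasis (Fin (m + 1)) ℝ V → A) : A :=
  if h : ∃ b : OrthonormalBasis (Fin (m + 1)) ℝ V, b 0 = u then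
    frameSign o h.choose • T h.choose else 0

end Frames

/-! ### Translation-invariant curvature measures on a euclidean space -/

section Euclidean

variable (V : Type*) [NormedAddCommGroup V] [InnerProductSpace ℝ V]

/-- A pair `(ψ, φ)` consisting of a translation-invariant `m`-form on the sphere bundle
`V × S(V)` and a translation-invariant `(m+1)`-form on `V`. The tangent space of `V × S(V)` at
`(x, u)` is `V × uᗮ ⊆ V × V`; the form `ψ` at `(x, u)` is given as (the restriction of) an
alternating form `sphereForm u` on `V × V`. Only its values for `‖u‖ = 1` and on `V × uᗮ`
matter. -/
structure InvFormPair (m : ℕ) where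
  sphereForm : V → (V × V) [⋀^Fin m]→ₗ[ℝ] ℝ
  volForm : V [⋀^Fin (m + 1)]→ₗ[ℝ] ℝ

variable {V}

open Classical in
/-- A point of `P` nearest to `y`; it is unique if `P` is nonempty, closed and convex. -/
def nearestPoint (P : Set V) (y : V) : V :=
  if h : ∃ q ∈ P, dist y q = Metric.infDist y P then h.choose else y

/-- The map `y ↦ (p, u)` from the complement of the convex body `P` to `V × S(V)`, where `p` is
the point of `P` nearest to `y` and `u` is the unit vector in the direction `y - p`. It restricts
to a bi-Lipschitz homeomorphism from the parallel hypersurface at distance one onto the unit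
normal bundle of `P`. -/
def normalMap (P : Set V) (y : V) : V × V :=
  (nearestPoint P y, ‖y - nearestPoint P y‖⁻¹ • (y - nearestPoint P y))

/-- The set of `k`-dimensional (nonempty) faces of a convex polytope, `P` itself included. -/
def faces (P : Set V) (k : ℕ) : Set (Set V) :=
  {F | F.Nonempty ∧ IsExposed ℝ P F ∧ Module.finrank ℝ (vectorSpan ℝ F) = k}

/-- The cone of outer normals of `P` along `F`. -/
def normalCone (F P : Set V) : Set V :=
  {w | ∀ p ∈ F, ∀ q ∈ P, inner ℝ w (q - p) ≤ 0}

variable [FiniteDimensional ℝ V] [MeasurableSpace V] [BorelSpace V] {m : ℕ}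

/-- `k`-dimensional Hausdorff measure on `V`, normalized so that the unit cube of `ℝᵏ` has
measure one. -/
def hausdorff (k : ℕ) : MeasureTheory.Measure V :=
  (μH[(k : ℝ)] {x : EuclideanSpace ℝ (Fin k) | ∀ i, x i ∈ Set.Icc (0 : ℝ) 1})⁻¹ • μH[(k : ℝ)]

/-- The integral of the form `ψ` over the part of the normal cycle of the convex body `P` that
lies over `E`. The normal cycle is the image under `normalMap P` of the hypersurface
`{y | dist(y, P) = 1}`, oriented as the boundary of `{y | dist(y, P) ≤ 1}`
(outer normal first). -/
def integralNormalCycle (o : Orientation ℝ V (Fin (m + 1)))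
    (ψ : V → (V × V) [⋀^Fin m]→ₗ[ℝ] ℝ) (P E : Set V) : ℝ :=
  ∫ y in {y | Metric.infDist y P = 1 ∧ (normalMap P y).1 ∈ E},
    adaptedFrameValue o (normalMap P y).2 (fun b =>
      ψ (normalMap P y).2 (fun i : Fin m => fderiv ℝ (normalMap P) y (b i.succ)))
    ∂(hausdorff m)

/-- The signed measure `Ψ(P, ·)`, evaluated at `E`, for the curvature measure `Ψ = [ψ, φ]`. -/
def InvFormPair.curvature (o : Orientation ℝ V (Fin (m + 1))) (Ψ : InvFormPair V m)
    (P E : Set V) : ℝ :=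
  integralNormalCycle o Ψ.sphereForm P E +
    ∫ _y in P ∩ E, frameValue o (fun b => Ψ.volForm b)

/-- The exterior solid angle of `P` along its face `F`: the fraction of the unit ball of the
orthogonal complement of the direction of `F` that is filled by the normal cone. -/
def exteriorAngle (F P : Set V) : ℝ :=
  let d := Module.finrank ℝ (vectorSpan ℝ F)ᗮ
  (hausdorff d (normalCone F P ∩ Metric.closedBall (0 : V) 1)).toReal /
    (hausdorff d (((vectorSpan ℝ F)ᗮ : Set V) ∩ Metric.closedBall (0 : V) 1)).toReal

/-- The translation-invariant curvature measure `Ψ` is angular: there is a function `c` on the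
(disjoint union of the) Grassmannians of `V` such that, for every convex polytope `P`,
`Ψ(P, ·) = ∑ₖ ∑_F c(F⃗) ∠(F, P) 𝓗ₖ|F`, the inner sum being over the finitely many `k`-faces. -/
def InvFormPair.IsAngular (o : Orientation ℝ V (Fin (m + 1))) (Ψ : InvFormPair V m) : Prop :=
  ∃ c : Submodule ℝ V → ℝ, ∀ s : Finset V, s.Nonempty → ∀ E : Set V, MeasurableSet E →
    Ψ.curvature o (convexHull ℝ (s : Set V)) E =
      ∑ k ∈ Finset.range (Module.finrank ℝ V + 1),
        ∑ᶠ F ∈ faces (convexHull ℝ (s : Set V)) k,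
          c (vectorSpan ℝ F) * exteriorAngle F (convexHull ℝ (s : Set V)) *
            (hausdorff k (F ∩ E)).toReal

end Euclidean

/-! ### Christoffel symbols and curvature of a metric on an open subset of a vector space -/

section Local

variable {E : Type*} [NormedAddCommGroup E] [NormedSpace ℝ E]

/-- The Christoffel symbols of the metric `g`, i.e. the bilinear map `Γ` at the point `z` such that
`2 g(Γ(u, v), w) = ∂ᵤ g(v, w) + ∂ᵥ g(u, w) - ∂_w g(u, v)`. -/
def christoffel (g : E → E →L[ℝ] E →L[ℝ] ℝ) (z : E) : E →L[ℝ] E →L[ℝ] E :=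
  let D : E →L[ℝ] E →L[ℝ] E →L[ℝ] ℝ := fderiv ℝ g z
  let K : E →L[ℝ] E →L[ℝ] E →L[ℝ] ℝ :=
    (2 : ℝ)⁻¹ • (D + D.flip -
      (ContinuousLinearMap.flipₗᵢ ℝ E E ℝ).toContinuousLinearEquiv.toContinuousLinearMap.comp
        D.flip)
  (ContinuousLinearMap.compL ℝ E (E →L[ℝ] ℝ) E (g z).inverse).comp K

/-- The curvature tensor `R(u, v)w = ∇ᵤ∇ᵥw - ∇ᵥ∇ᵤw - ∇_{[u,v]}w` of the metric `g` at `z`. -/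
def curvatureTensor (g : E → E →L[ℝ] E →L[ℝ] ℝ) (z u v w : E) : E :=
  fderiv ℝ (christoffel g) z u v w - fderiv ℝ (christoffel g) z v u w
    + christoffel g z u (christoffel g z v w) - christoffel g z v (christoffel g z u w)

/-- `(u, v) ↦ l(R(u, v)w)` as a bilinear form. -/
def curvatureBilin (g : E → E →L[ℝ] E →L[ℝ] ℝ) (z : E) (l : E →ₗ[ℝ] ℝ) (w : E) :
    E →ₗ[ℝ] E →ₗ[ℝ] ℝ :=
  LinearMap.mk₂ ℝ (fun u v => l (curvatureTensor g z u v w))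
    (fun u u' v => by simp [curvatureTensor]; ring)
    (fun c u v => by simp [curvatureTensor]; ring)
    (fun u v v' => by simp [curvatureTensor]; ring)
    (fun c u v => by simp [curvatureTensor]; ring)

end Local

/-! ### Riemannian manifolds -/

section Riemannian

variable {E : Type*} [NormedAddCommGroup E] [NormedSpace ℝ E]
  {M : Type*} [TopologicalSpace M] [ChartedSpace E M] [IsManifold 𝓘(ℝ, E) ∞ M]

instance finiteDimensionalTangent [FiniteDimensional ℝ E] (x : M) : FiniteDimensional ℝ (TangentSpace 𝓘(ℝ, E) x) :=
  inferInstanceAs (FiniteDimensional ℝ E)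

instance measurableSpaceTangent (x : M) : MeasurableSpace (TangentSpace 𝓘(ℝ, E) x) := borel _

instance borelSpaceTangent (x : M) : BorelSpace (TangentSpace 𝓘(ℝ, E) x) := ⟨rfl⟩

/-- The derivative `T_ξ(TM) → T_x M` of the projection `TM → M` at `ξ ∈ T_x M`. -/
def projDeriv (ξ : TangentBundle 𝓘(ℝ, E) M) :
    TangentSpace 𝓘(ℝ, E).tangent ξ →ₗ[ℝ] TangentSpace 𝓘(ℝ, E) ξ.proj :=
  (mfderiv 𝓘(ℝ, E).tangent 𝓘(ℝ, E) (Bundle.TotalSpace.proj : TangentBundle 𝓘(ℝ, E) M → M) ξ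
    : TangentSpace 𝓘(ℝ, E).tangent ξ →L[ℝ] TangentSpace 𝓘(ℝ, E) ξ.proj)

variable [Bundle.RiemannianBundle (fun x : M => TangentSpace 𝓘(ℝ, E) x)]

/-- The Riemannian metric read in the chart at `x`. -/
def chartMetric (x : M) (z : E) : E →L[ℝ] E →L[ℝ] ℝ :=
  let y : M := (extChartAt 𝓘(ℝ, E) x).symm z
  let L : E →L[ℝ] TangentSpace 𝓘(ℝ, E) y :=
    (trivializationAt E (TangentSpace 𝓘(ℝ, E) : M → Type _) x).symmL ℝ y
  (innerSL ℝ (E := TangentSpace 𝓘(ℝ, E) y)).bilinearComp L L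

/-- The Christoffel symbols of the Levi-Civita connection at `x`, in the chart at `x`. By
construction of `TangentSpace`, this chart identifies the tangent space at `x` with `E`. -/
def christoffelAt (x : M) : E →L[ℝ] E →L[ℝ] E :=
  christoffel (chartMetric x) (extChartAt 𝓘(ℝ, E) x x)

/-- The curvature form `Ω_ij(u, v) = ⟨b_i, R(u, v) b_j⟩` at `x`, for `bi, bj ∈ T_x M`. -/
def curvatureForm (x : M) (bi bj : TangentSpace 𝓘(ℝ, E) x) :
    TangentSpace 𝓘(ℝ, E) x →ₗ[ℝ] TangentSpace 𝓘(ℝ, E) x →ₗ[ℝ] ℝ :=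
  curvatureBilin (E := E) (chartMetric x) (extChartAt 𝓘(ℝ, E) x x)
    (innerₛₗ ℝ (E := TangentSpace 𝓘(ℝ, E) x) bi) bj

/-- The connection map `T_ξ(TM) → T_x M` of the Levi-Civita connection at `ξ ∈ T_x M`: it sends the
velocity of a vector field along a curve to the covariant derivative of that field. In the chart of
`TM` induced by the chart at `x`, which identifies `T_ξ(TM)` with `E × E`, it is
`(h, w) ↦ w + Γ(h, ξ)`. -/
def connectionMap (ξ : TangentBundle 𝓘(ℝ, E) M) :
    TangentSpace 𝓘(ℝ, E).tangent ξ →ₗ[ℝ] TangentSpace 𝓘(ℝ, E) ξ.proj :=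
  let f : E × E →ₗ[ℝ] E := LinearMap.snd ℝ E E +
    ((christoffelAt (E := E) ξ.proj).flip ξ.2).toLinearMap ∘ₗ LinearMap.fst ℝ E E
  f

/-- The isomorphism `T_x M × T_x M → T_u(TM)`, `u ∈ T_x M`, that sends `(h, w)` to the sum of the
horizontal lift of `h` and the vertical lift of `w`; it is the inverse of
`(projDeriv, connectionMap)`. It maps `T_x M × uᗮ` onto the tangent space of the sphere bundle if
`‖u‖ = 1`. -/
def liftMap (x : M) (u : TangentSpace 𝓘(ℝ, E) x) :
    (TangentSpace 𝓘(ℝ, E) x × TangentSpace 𝓘(ℝ, E) x) →ₗ[ℝ]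
      TangentSpace 𝓘(ℝ, E).tangent (⟨x, u⟩ : TangentBundle 𝓘(ℝ, E) M) :=
  let f : E × E →ₗ[ℝ] E × E := LinearMap.prod (LinearMap.fst ℝ E E)
    (LinearMap.snd ℝ E E - ((christoffelAt (E := E) x).flip u).toLinearMap ∘ₗ LinearMap.fst ℝ E E)
  f

section Realization

variable {m : ℕ}

/-- The realization `θ_i(v) = ⟨b_i, dπ(v)⟩` of the coframe forms at `ξ ∈ SM`. -/
def theta (ξ : TangentBundle 𝓘(ℝ, E) M)
    (b : OrthonormalBasis (Fin (m + 1)) ℝ (TangentSpace 𝓘(ℝ, E) ξ.proj)) (i : Fin (m + 1)) :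
    TangentSpace 𝓘(ℝ, E).tangent ξ →ₗ[ℝ] ℝ :=
  innerₛₗ ℝ (b i) ∘ₗ projDeriv ξ

/-- The realization `ω_{i0}(v) = ⟨b_i, ∇ᵥ b₀⟩` of the connection forms at `ξ ∈ SM`. For every local
section `(b₀, …, b_m)` of the bundle of adapted frames over `SM`, the vector field `b₀` along
`SM → M` is tautological, so that `∇ᵥ b₀` is the image of `v` under the connection map. -/
def omegaZero (ξ : TangentBundle 𝓘(ℝ, E) M)
    (b : OrthonormalBasis (Fin (m + 1)) ℝ (TangentSpace 𝓘(ℝ, E) ξ.proj)) (i : Fin (m + 1)) :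
    TangentSpace 𝓘(ℝ, E).tangent ξ →ₗ[ℝ] ℝ :=
  innerₛₗ ℝ (b i) ∘ₗ connectionMap ξ

/-- The realization of the curvature forms `Ω_ij` at `ξ ∈ SM`. -/
def bigOmega (ξ : TangentBundle 𝓘(ℝ, E) M)
    (b : OrthonormalBasis (Fin (m + 1)) ℝ (TangentSpace 𝓘(ℝ, E) ξ.proj)) (i j : Fin (m + 1)) :
    TangentSpace 𝓘(ℝ, E).tangent ξ →ₗ[ℝ] TangentSpace 𝓘(ℝ, E).tangent ξ →ₗ[ℝ] ℝ :=
  (curvatureForm ξ.proj (b i) (b j)).compl₁₂ (projDeriv ξ) (projDeriv ξ)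

/-- The realization at `ξ ∈ SM`, with respect to a frame `b` with `b₀ = ξ`, of
`φ_{kp} = ∑_π sgn(π) Ω_{π₁π₂} ⋯ Ω_{π_{2p-1}π_{2p}} θ_{π_{2p+1}} ⋯ θ_{π_k} ω_{π_{k+1}0} ⋯ ω_{π_m 0}`,
the sum being over the permutations of `{1, …, m}`. -/
def phiFrame (k p : ℕ) (hp : 2 * p ≤ m) (ξ : TangentBundle 𝓘(ℝ, E) M)
    (b : OrthonormalBasis (Fin (m + 1)) ℝ (TangentSpace 𝓘(ℝ, E) ξ.proj)) :
    TangentSpace 𝓘(ℝ, E).tangent ξ [⋀^Fin m]→ₗ[ℝ] ℝ :=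
  ∑ τ : Equiv.Perm (Fin m), ((Equiv.Perm.sign τ : ℤ) : ℝ) •
    wedge hp
      (fun j => bigOmega ξ b (τ ⟨2 * j, by omega⟩).succ (τ ⟨2 * j + 1, by omega⟩).succ)
      (fun i => if (i : ℕ) < k then theta ξ b (τ i).succ else omegaZero ξ b (τ i).succ)

/-- The realization at `x`, with respect to the frame `b`, of
`ψ_p = ∑_π sgn(π) Ω_{π₀π₁} ⋯ Ω_{π_{2p-2}π_{2p-1}} θ_{π_{2p}} ⋯ θ_{π_m}`, the sum being over the
permutations of `{0, …, m}`. -/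
def psiFrame (p : ℕ) (hp : 2 * p ≤ m + 1) (x : M)
    (b : OrthonormalBasis (Fin (m + 1)) ℝ (TangentSpace 𝓘(ℝ, E) x)) :
    TangentSpace 𝓘(ℝ, E) x [⋀^Fin (m + 1)]→ₗ[ℝ] ℝ :=
  ∑ τ : Equiv.Perm (Fin (m + 1)), ((Equiv.Perm.sign τ : ℤ) : ℝ) •
    wedge hp
      (fun j => curvatureForm x (b (τ ⟨2 * j, by omega⟩)) (b (τ ⟨2 * j + 1, by omega⟩)))
      (fun i => innerₛₗ ℝ (b (τ i)))

end Realization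

variable (E M) in
/-- A pair `(ψ, φ)` of an `m`-form on the sphere bundle `SM` and an `(m+1)`-form on `M`, which
represents the curvature measure `[ψ, φ]`. The form `ψ` at `ξ ∈ SM` is given as (the restriction to
the tangent space of `SM` of) an alternating form on the tangent space of `TM`. -/
structure FormPair (m : ℕ) where
  sphereForm : ∀ ξ : TangentBundle 𝓘(ℝ, E) M, TangentSpace 𝓘(ℝ, E).tangent ξ [⋀^Fin m]→ₗ[ℝ] ℝ
  volForm : ∀ x : M, TangentSpace 𝓘(ℝ, E) x [⋀^Fin (m + 1)]→ₗ[ℝ] ℝ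

/-- The value at `x` of the section of translation-invariant curvature measures on the tangent
spaces that corresponds to a curvature measure on `M`: the tangent space of `SM` at `u` is
identified with `T_x M × uᗮ`, which is the tangent space of `T_x M × S(T_x M)` at `(·, u)`, by
means of the Levi-Civita connection. -/
def FormPair.transfer {m : ℕ} (Ψ : FormPair E M m) (x : M) :
    InvFormPair (TangentSpace 𝓘(ℝ, E) x) m where
  sphereForm u := (Ψ.sphereForm ⟨x, u⟩).compLinearMap (liftMap x u)
  volForm := Ψ.volForm x

/-- A curvature measure on `M` is angular if all the values of the associated section are. -/
def FormPair.IsAngular [FiniteDimensional ℝ E] {m : ℕ}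
    (o : ∀ x : M, Orientation ℝ (TangentSpace 𝓘(ℝ, E) x) (Fin (m + 1)))
    (Ψ : FormPair E M m) : Prop :=
  ∀ x : M, (Ψ.transfer x).IsAngular (o x)

/-- The volume of the unit ball of `ℝᵏ`. -/
def ballVol (k : ℕ) : ℝ :=
  (MeasureTheory.volume (Metric.ball (0 : EuclideanSpace ℝ (Fin k)) 1)).toReal

/-- The curvature measure `C_{kp}` on the Riemannian manifold `M` of dimension `m + 1`, with tangent
spaces oriented by `o`. Reversing the orientation at `x` changes the sign of the forms over `x` and
the sign of the integrals over `T_x M` and over normal cycles in it, hence does not change the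
associated signed measures. Continuity of `o` is therefore not needed, and `M` need not be
orientable. -/
def curvC {m : ℕ} (o : ∀ x : M, Orientation ℝ (TangentSpace 𝓘(ℝ, E) x) (Fin (m + 1)))
    (k p : ℕ) (hp : 2 * p ≤ k) : FormPair E M m where
  sphereForm ξ :=
    if hk : k < m + 1 then
      (ballVol k / (Real.pi ^ k * (m + 1 - k).factorial * ballVol (m + 1 - k))) •
        adaptedFrameValue (o ξ.proj) ξ.2 (phiFrame k p (by omega) ξ)
    else 0
  volForm x :=
    if hk : k = m + 1 then
      (ballVol k / Real.pi ^ k) • frameValue (o x) (psiFrame p (by omega) x)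
    else 0

end Riemannian

end RiemCurv

end

/-!
For a polytope `P`, the hypersurface `{y | dist(y, P) = 1}` is, up to null sets, the disjoint union
over the faces `F` of `P` of the sets `F + (unit outer normals of P along F)`. At a point `q + u` of
such a set, the derivative of `y ↦ (nearest point, unit normal)` is `w ↦ (w₁, w₂)`, where `w₁` and
`w₂` are the orthogonal projections of `w ⊥ u` to the direction `F⃗` of `F` and to its orthogonal
complement. A translation-invariant form on the normal cycle therefore contributes a function of
`F⃗` and `u`. If this function does not depend on `u`, the contribution of `F` is a constant
depending on `F⃗` times the solid angle of `P` along `F` times the measure of `F`.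

For `φ_{kp}`, take a frame adapted to `F⃗`. In a nonzero term of the alternating sum the factors `Ω`
and `θ` only involve frame vectors in `F⃗`, and the factors `ω` only frame vectors orthogonal to it.
The reflection that interchanges two unit normals `u` and `v` fixes `F⃗`, so it maps a frame adapted
to `u` to one adapted to `v` without changing any of these terms.
-/

noncomputable section

namespace RiemCurv

/-! ### Uniformly distributed measures -/

section UniformlyDistributed

open MeasureTheory Metric Filter

variable {X : Type*} [MetricSpace X] [MeasurableSpace X]

/-- The measure `μ` is uniformly distributed on the set `S`: it is concentrated on `S`, and the
measure of a ball centered on `S` depends on its radius only. -/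
structure UniformlyDistributedOn (μ : Measure X) (S : Set X) : Prop where
  compl_eq_zero : μ Sᶜ = 0
  closedBall_eq : ∀ x ∈ S, ∀ y ∈ S, ∀ r, μ (closedBall x r) = μ (closedBall y r)

theorem UniformlyDistributedOn.add {S : Set X} {μ ν : Measure X} (hμ : UniformlyDistributedOn μ S)
    (hν : UniformlyDistributedOn ν S) : UniformlyDistributedOn (μ + ν) S where
  compl_eq_zero := by simp [hμ.compl_eq_zero, hν.compl_eq_zero]
  closedBall_eq x hx y hy r := by simp [hμ.closedBall_eq x hx y hy r, hν.closedBall_eq x hx y hy r]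

theorem UniformlyDistributedOn.of_transitive [OpensMeasurableSpace X] {S : Set X} {μ : Measure X}
    (h0 : μ Sᶜ = 0)
    (htrans : ∀ x ∈ S, ∀ y ∈ S, ∃ g : X → X, Isometry g ∧ MeasurePreserving g μ μ ∧ g x = y) :
    UniformlyDistributedOn μ S := by
  refine ⟨h0, fun x hx y hy r => ?_⟩
  obtain ⟨g, hg, hpres, rfl⟩ := htrans x hx y hy
  rw [← hpres.measure_preimage (s := closedBall (g x) r)
    isClosed_closedBall.measurableSet.nullMeasurableSet, hg.preimage_closedBall]

theorem isLocallyFiniteMeasure_add (μ ν : Measure X) [IsLocallyFiniteMeasure μ]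
    [IsLocallyFiniteMeasure ν] : IsLocallyFiniteMeasure (μ + ν) := by
  refine ⟨fun x => ?_⟩
  obtain ⟨s, hs, hμs⟩ := μ.finiteAt_nhds x
  obtain ⟨t, ht, hνt⟩ := ν.finiteAt_nhds x
  refine ⟨s ∩ t, inter_mem hs ht, ?_⟩
  rw [Measure.add_apply]
  exact ENNReal.add_lt_top.2 ⟨measure_lt_top_of_subset Set.inter_subset_left hμs.ne,
    measure_lt_top_of_subset Set.inter_subset_right hνt.ne⟩

variable [BorelSpace X] [SecondCountableTopology X] [HasBesicovitchCovering X]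

/-- By the Besicovitch differentiation theorem the density of `μ` with respect to `ρ` is the limit
of the quotients of the measures of small balls, hence constant. -/
theorem UniformlyDistributedOn.exists_eq_smul_of_le {S : Set X} {μ ρ : Measure X}
    [IsLocallyFiniteMeasure ρ] (hμ : UniformlyDistributedOn μ S) (hρ : UniformlyDistributedOn ρ S)
    (hle : μ ≤ ρ) : ∃ c : ENNReal, c ≠ ⊤ ∧ μ = c • ρ := by
  rcases eq_zero_or_neZero ρ with rfl | _
  · exact ⟨0, ENNReal.zero_ne_top, by simpa using le_antisymm hle (Measure.zero_le μ)⟩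
  have : IsLocallyFiniteMeasure μ := Measure.isLocallyFiniteMeasure_of_le hle
  have hS : ∀ᵐ x ∂ρ, x ∈ S := hρ.compl_eq_zero
  have hlim := Besicovitch.ae_tendsto_rnDeriv μ ρ
  obtain ⟨x₀, hx₀S, hx₀, hfin⟩ := (hS.and (hlim.and (Measure.rnDeriv_lt_top μ ρ))).exists
  have hconst : μ.rnDeriv ρ =ᵐ[ρ] fun _ => μ.rnDeriv ρ x₀ := by
    filter_upwards [hS, hlim] with x hxS hx
    refine tendsto_nhds_unique hx (hx₀.congr fun r => ?_)
    rw [hμ.closedBall_eq x₀ hx₀S x hxS, hρ.closedBall_eq x₀ hx₀S x hxS]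
  refine ⟨μ.rnDeriv ρ x₀, hfin.ne, ?_⟩
  rw [← withDensity_const, ← withDensity_congr_ae hconst,
    Measure.withDensity_rnDeriv_eq μ ρ (Measure.absolutelyContinuous_of_le hle)]

theorem UniformlyDistributedOn.exists_eq_smul {S : Set X} {μ ν : Measure X}
    [IsLocallyFiniteMeasure μ] [IsLocallyFiniteMeasure ν] (hμ : UniformlyDistributedOn μ S)
    (hν : UniformlyDistributedOn ν S) (hν0 : ν ≠ 0) : ∃ c : ENNReal, c ≠ ⊤ ∧ μ = c • ν := by
  have := isLocallyFiniteMeasure_add μ ν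
  obtain ⟨a, ha, hμa⟩ := hμ.exists_eq_smul_of_le (hμ.add hν) (Measure.le_add_right le_rfl)
  obtain ⟨b, hb, hνb⟩ := hν.exists_eq_smul_of_le (hμ.add hν) (Measure.le_add_left le_rfl)
  have hb0 : b ≠ 0 := by
    rintro rfl
    exact hν0 (by simpa using hνb)
  refine ⟨a * b⁻¹, ENNReal.mul_ne_top ha (ENNReal.inv_ne_top.2 hb0), ?_⟩
  calc μ = a • (μ + ν) := hμa
    _ = (a * b⁻¹) • b • (μ + ν) := by
        rw [smul_smul, mul_assoc, ENNReal.inv_mul_cancel hb0 hb, mul_one]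
    _ = (a * b⁻¹) • ν := by rw [← hνb]

end UniformlyDistributed

/-! ### Hausdorff measures -/

section Hausdorff

open MeasureTheory Measure Module
open scoped Pointwise

theorem volume_unitCube (k : ℕ) :
    volume {x : EuclideanSpace ℝ (Fin k) | ∀ i, x i ∈ Set.Icc (0 : ℝ) 1} = 1 := by
  have hcube : {x : EuclideanSpace ℝ (Fin k) | ∀ i, x i ∈ Set.Icc (0 : ℝ) 1} =
      WithLp.ofLp ⁻¹' Set.univ.pi fun _ => Set.Icc (0 : ℝ) 1 := by
    ext x
    simp [Pi.le_def, forall_and]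
  rw [hcube, (PiLp.volume_preserving_ofLp (Fin k)).measure_preimage
    (MeasurableSet.univ_pi fun _ => measurableSet_Icc).nullMeasurableSet, volume_pi_pi]
  simp

theorem vadd_image_coe_eq {R M : Type*} [Ring R] [AddCommGroup M] [Module R M] {U : Submodule R M}
    {A : Set M} {x : M} (hA : ∀ a ∈ A, a - x ∈ U) :
    x +ᵥ (↑) '' {a : U | x + (a : M) ∈ A} = A := by
  ext y
  simp only [Set.mem_vadd_set, Set.mem_image, Set.mem_ofPred_eq, vadd_eq_add,
    exists_exists_and_eq_and]
  constructor
  · rintro ⟨a, ha, rfl⟩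
    exact ha
  · exact fun hy => ⟨⟨y - x, hA y hy⟩, by simpa using hy, by simp⟩

variable {V : Type*} [NormedAddCommGroup V] [MeasurableSpace V] [BorelSpace V]

theorem hausdorff_eq_euclideanHausdorffMeasure (k : ℕ) : (hausdorff k : Measure V) = μHE[k] := by
  have hcube := DFunLike.congr_fun (EuclideanSpace.euclideanHausdorffMeasure_eq_volume k)
    {x | ∀ i, x i ∈ Set.Icc (0 : ℝ) 1}
  rw [volume_unitCube, euclideanHausdorffMeasure_def, Measure.smul_apply, ENNReal.smul_def,
    smul_eq_mul] at hcube
  rw [euclideanHausdorffMeasure_def, hausdorff, ENNReal.smul_def,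
    ENNReal.eq_inv_of_mul_eq_one_left hcube]

theorem hausdorff_vadd (k : ℕ) (v : V) (A : Set V) : hausdorff k (v +ᵥ A) = hausdorff k A := by
  rw [hausdorff_eq_euclideanHausdorffMeasure, measure_vadd]

variable [InnerProductSpace ℝ V] [FiniteDimensional ℝ V] {U : Submodule ℝ V} {A : Set V} {x : V}

theorem hausdorff_eq_volume_of_sub_mem (hA : ∀ a ∈ A, a - x ∈ U) :
    hausdorff (finrank ℝ U) A = volume {a : U | x + (a : V) ∈ A} := by
  nth_rw 1 [← vadd_image_coe_eq hA]
  rw [hausdorff_vadd, hausdorff_eq_euclideanHausdorffMeasure,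
    isometry_subtype_coe.euclideanHausdorffMeasure_image,
    InnerProductSpace.euclideanHausdorffMeasure_eq_volume]

theorem hausdorff_lt_top_of_isBounded (hA : ∀ a ∈ A, a - x ∈ U) (hb : Bornology.IsBounded A) :
    hausdorff (finrank ℝ U) A < ⊤ := by
  obtain ⟨r, hr⟩ := hb.subset_closedBall x
  have hball : {a : U | x + (a : V) ∈ A} ⊆ Metric.closedBall 0 r := fun a ha => by
    simpa using hr ha
  rw [hausdorff_eq_volume_of_sub_mem hA]
  exact measure_lt_top_of_subset hball measure_closedBall_lt_top.ne

end Hausdorff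

/-! ### The unit cylinder around a subspace -/

section Cylinder

open MeasureTheory Measure Metric Filter Topology Submodule Module
open scoped Pointwise

variable {V : Type*} [NormedAddCommGroup V] [InnerProductSpace ℝ V]

theorem neg_vadd_subset_of_sub_mem {W : Submodule ℝ V} {A : Set V} {x : V}
    (hA : ∀ a ∈ A, a - x ∈ W) : -x +ᵥ A ⊆ W := by
  rintro _ ⟨a, ha, rfl⟩
  simpa [vadd_eq_add, neg_add_eq_sub] using hA a ha

variable (W : Submodule ℝ V) [W.HasOrthogonalProjection]

/-- The unit cylinder around `W`, the set of the points at distance one from `W`. -/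
def cylinder : Set V := {y | ‖Wᗮ.starProjection y‖ = 1}

/-- The radial retraction onto the unit cylinder around `W`. Points of `W` are fixed, because
`0⁻¹ = 0`. -/
def cylinderRetract (y : V) : V :=
  W.starProjection y + ‖Wᗮ.starProjection y‖⁻¹ • Wᗮ.starProjection y

/-- The solid unit cylinder around `W`, without `W` itself. -/
def solidCylinder : Set V := {y | ‖Wᗮ.starProjection y‖ ∈ Set.Ioc (0 : ℝ) 1}

variable {W} in
theorem starProjection_add_of_mem {a w : V} (ha : a ∈ W) (hw : w ∈ Wᗮ) :
    W.starProjection (a + w) = a := by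
  rw [map_add, starProjection_eq_self_iff.2 ha, (starProjection_apply_eq_zero_iff W).2 hw, add_zero]

variable {W} in
theorem starProjection_orthogonal_add_of_mem {a w : V} (ha : a ∈ W) (hw : w ∈ Wᗮ) :
    Wᗮ.starProjection (a + w) = w := by
  rw [starProjection_orthogonal_val, starProjection_add_of_mem ha hw, add_sub_cancel_left]

variable {W} in
theorem cylinderRetract_add {a w : V} (ha : a ∈ W) (hw : w ∈ Wᗮ) :
    cylinderRetract W (a + w) = a + ‖w‖⁻¹ • w := by
  rw [cylinderRetract, starProjection_add_of_mem ha hw, starProjection_orthogonal_add_of_mem ha hw]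

theorem starProjection_cylinderRetract (y : V) :
    W.starProjection (cylinderRetract W y) = W.starProjection y :=
  starProjection_add_of_mem (starProjection_apply_mem _ _)
    (smul_mem _ _ (starProjection_apply_mem _ _))

theorem starProjection_orthogonal_cylinderRetract (y : V) :
    Wᗮ.starProjection (cylinderRetract W y) =
      ‖Wᗮ.starProjection y‖⁻¹ • Wᗮ.starProjection y :=
  starProjection_orthogonal_add_of_mem (starProjection_apply_mem _ _)
    (smul_mem _ _ (starProjection_apply_mem _ _))

theorem cylinderRetract_mem_cylinder {y : V} (hy : Wᗮ.starProjection y ≠ 0) :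
    cylinderRetract W y ∈ cylinder W := by
  rw [cylinder, Set.mem_ofPred_eq, starProjection_orthogonal_cylinderRetract, norm_smul, norm_inv,
    norm_norm, inv_mul_cancel₀ (norm_ne_zero_iff.2 hy)]

variable {W} in
theorem mem_add_iff_starProjection_mem {A N : Set V} (hA : A ⊆ W) (hN : N ⊆ Wᗮ) {y : V} :
    y ∈ A + N ↔ W.starProjection y ∈ A ∧ Wᗮ.starProjection y ∈ N := by
  refine ⟨?_, fun h => ⟨_, h.1, _, h.2, W.starProjection_add_starProjection_orthogonal y⟩⟩
  rintro ⟨a, ha, w, hw, rfl⟩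
  exact ⟨(starProjection_add_of_mem (hA ha) (hN hw)).symm ▸ ha,
    (starProjection_orthogonal_add_of_mem (hA ha) (hN hw)).symm ▸ hw⟩

theorem cylinderRetract_starProjection_add_smul {y : V} (hy : y ∈ cylinder W) {t : ℝ} (ht : 0 < t) :
    cylinderRetract W (W.starProjection y + t • Wᗮ.starProjection y) = y := by
  rw [cylinderRetract_add (starProjection_apply_mem _ _)
    (smul_mem _ _ (starProjection_apply_mem _ _)), norm_smul,
    show ‖Wᗮ.starProjection y‖ = 1 from hy, mul_one, Real.norm_of_nonneg ht.le,
    inv_smul_smul₀ ht.ne', starProjection_add_starProjection_orthogonal]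

variable {W} in
theorem inner_starProjection_of_mem {u : V} (hu : u ∈ W) (y : V) :
    inner ℝ u (W.starProjection y) = inner ℝ u y := by
  rw [← inner_starProjection_left_eq_right, starProjection_eq_self_iff.2 hu]

variable {W} in
theorem starProjection_add_inv_smul_sub_mem {u y : V} (hu : u ∈ Wᗮ) (hu1 : ‖u‖ = 1)
    (hy : inner ℝ u y ≠ 0) :
    W.starProjection y + (inner ℝ u y)⁻¹ • Wᗮ.starProjection y - u ∈ (ℝ ∙ u)ᗮ := by
  rw [mem_orthogonal_singleton_iff_inner_right, inner_sub_right, inner_add_right, inner_smul_right,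
    inner_starProjection_of_mem hu, inv_mul_cancel₀ hy,
    inner_left_of_mem_orthogonal (starProjection_apply_mem _ _) hu, real_inner_self_eq_norm_sq,
    hu1, one_pow, zero_add, sub_self]

theorem contDiffAt_cylinderRetract {y : V} (hy : Wᗮ.starProjection y ≠ 0) {n : ℕ∞} :
    ContDiffAt ℝ n (cylinderRetract W) y := by
  have hQ : ContDiffAt ℝ n (fun z => Wᗮ.starProjection z) y := Wᗮ.starProjection.contDiff.contDiffAt
  exact W.starProjection.contDiff.contDiffAt.add
    (((hQ.norm ℝ hy).inv (norm_ne_zero_iff.2 hy)).smul hQ)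

theorem isClosed_cylinder : IsClosed (cylinder W) :=
  isClosed_eq (by fun_prop) continuous_const

theorem exists_isometryEquiv_cylinder {x y : V} (hx : x ∈ cylinder W) (hy : y ∈ cylinder W) :
    ∃ g : V ≃ᵢ V, g x = y ∧ (∀ z, ‖Wᗮ.starProjection (g z)‖ = ‖Wᗮ.starProjection z‖) ∧
      ∀ z, cylinderRetract W (g z) = g (cylinderRetract W z) := by
  set u := Wᗮ.starProjection x
  set v := Wᗮ.starProjection y
  set a := W.starProjection y - W.starProjection x
  set ρ := (ℝ ∙ (u - v))ᗮ.reflection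
  have huv : ‖u‖ = ‖v‖ := hx.trans hy.symm
  have hρ_fix : ∀ w ∈ W, ρ w = w := fun w hw => by
    refine reflection_mem_subspace_eq_self (mem_orthogonal_singleton_iff_inner_right.2 ?_)
    exact inner_left_of_mem_orthogonal hw
      (sub_mem (starProjection_apply_mem _ _) (starProjection_apply_mem _ _))
  have hρ_orth : ∀ w ∈ Wᗮ, ρ w ∈ Wᗮ := fun w hw z hz => by
    rw [← hρ_fix z hz, LinearIsometryEquiv.inner_map_map]
    exact hw z hz
  have ha : a ∈ W := sub_mem (starProjection_apply_mem _ _) (starProjection_apply_mem _ _)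
  have hmove : ∀ p ∈ W, ∀ q : V, ρ (p + q) + a = (p + a) + ρ q := fun p hp q => by
    rw [map_add, hρ_fix p hp]; abel
  refine ⟨ρ.toIsometryEquiv.trans (IsometryEquiv.addRight a), ?_, fun z => ?_, fun z => ?_⟩
  all_goals
    simp only [IsometryEquiv.trans_apply, LinearIsometryEquiv.coe_toIsometryEquiv,
      IsometryEquiv.addRight_apply]
  · rw [← W.starProjection_add_starProjection_orthogonal x,
      hmove _ (starProjection_apply_mem _ _), reflection_sub huv, add_sub_cancel,
      W.starProjection_add_starProjection_orthogonal]
  · nth_rewrite 1 [← W.starProjection_add_starProjection_orthogonal z]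
    rw [hmove _ (starProjection_apply_mem _ _), starProjection_orthogonal_add_of_mem
      (add_mem (starProjection_apply_mem _ _) ha) (hρ_orth _ (starProjection_apply_mem _ _)),
      LinearIsometryEquiv.norm_map]
  · nth_rewrite 1 [← W.starProjection_add_starProjection_orthogonal z]
    rw [hmove _ (starProjection_apply_mem _ _), cylinderRetract_add
      (add_mem (starProjection_apply_mem _ _) ha) (hρ_orth _ (starProjection_apply_mem _ _)),
      LinearIsometryEquiv.norm_map, cylinderRetract, hmove _ (starProjection_apply_mem _ _),
      map_smul]

section Measure

variable [MeasurableSpace V] [BorelSpace V]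

theorem euclideanHausdorffMeasure_image_lt_top {X Y : Type*} [EMetricSpace X] [MeasurableSpace X]
    [BorelSpace X] [EMetricSpace Y] [MeasurableSpace Y] [BorelSpace Y] {d : ℕ} {C : NNReal}
    {f : X → Y} {s : Set X} (hf : LipschitzOnWith C f s) (hs : μHE[d] s < ⊤) :
    μHE[d] (f '' s) < ⊤ := by
  have hle : μHE[d] (f '' s) ≤ (C : ENNReal) ^ (d : ℝ) * μHE[d] s := by
    simp only [euclideanHausdorffMeasure_def, Measure.smul_apply, ENNReal.smul_def, smul_eq_mul]
    rw [mul_left_comm]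
    gcongr
    exact hf.hausdorffMeasure_image_le (Nat.cast_nonneg d)
  refine hle.trans_lt (ENNReal.mul_lt_top ?_ hs)
  exact ENNReal.rpow_lt_top_of_nonneg (Nat.cast_nonneg d) ENNReal.coe_ne_top

theorem euclideanHausdorffMeasure_singleton {X : Type*} [EMetricSpace X] [MeasurableSpace X]
    [BorelSpace X] {d : ℕ} (hd : d ≠ 0) (x : X) :
    μHE[d] ({x} : Set X) = 0 := by
  have := nullSingletonClass_hausdorff X (d := d) (by positivity)
  rw [euclideanHausdorffMeasure_def, Measure.smul_apply, measure_singleton, smul_zero]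

theorem measurableSet_solidCylinder : MeasurableSet (solidCylinder W) :=
  (Wᗮ.starProjection.continuous.norm.measurable) measurableSet_Ioc

variable {W} in
theorem measurableSet_add {A N : Set V} (hA : A ⊆ W) (hN : N ⊆ Wᗮ) (hAm : MeasurableSet A)
    (hNm : MeasurableSet N) : MeasurableSet (A + N) := by
  rw [show A + N = W.starProjection ⁻¹' A ∩ Wᗮ.starProjection ⁻¹' N from
    Set.ext fun y => mem_add_iff_starProjection_mem hA hN]
  exact (W.starProjection.continuous.measurable hAm).inter
    (Wᗮ.starProjection.continuous.measurable hNm)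

variable {W} in
theorem measurableSet_add_of_sub_mem {A N : Set V} {x : V} (hA : ∀ a ∈ A, a - x ∈ W)
    (hN : N ⊆ Wᗮ) (hAm : MeasurableSet A) (hNm : MeasurableSet N) : MeasurableSet (A + N) := by
  have h := measurableSet_add (neg_vadd_subset_of_sub_mem hA) hN (hAm.const_vadd _) hNm
  rw [vadd_add_assoc] at h
  simpa using h.const_vadd x

theorem uniformlyDistributedOn_euclideanHausdorffMeasure_restrict_cylinder (m : ℕ) :
    UniformlyDistributedOn ((μHE[m] : Measure V).restrict (cylinder W)) (cylinder W) := by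
  have hmeas := (isClosed_cylinder W).measurableSet
  refine .of_transitive (by simp [restrict_apply' hmeas]) fun x hx y hy => ?_
  obtain ⟨g, hgx, hnorm, -⟩ := exists_isometryEquiv_cylinder W hx hy
  have hpre : g ⁻¹' cylinder W = cylinder W := by
    ext z
    simp only [cylinder, Set.mem_preimage, Set.mem_ofPred_eq, hnorm]
  have hg := (g.measurePreserving_euclideanHausdorffMeasure m).restrict_preimage hmeas
  rw [hpre] at hg
  exact ⟨g, g.isometry, hg, hgx⟩

variable [FiniteDimensional ℝ V]

theorem measurable_cylinderRetract : Measurable (cylinderRetract W) := by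
  unfold cylinderRetract
  fun_prop

/-- The measure on the unit cylinder around `W` which is the image of the volume of the solid
cylinder under the radial retraction. -/
def cylinderMeasure : Measure V :=
  (volume.restrict (solidCylinder W)).map (cylinderRetract W)

theorem cylinderMeasure_apply {S : Set V} (hS : MeasurableSet S) :
    cylinderMeasure W S = volume (cylinderRetract W ⁻¹' S ∩ solidCylinder W) := by
  rw [cylinderMeasure, map_apply (measurable_cylinderRetract W) hS,
    restrict_apply (measurable_cylinderRetract W hS)]

theorem uniformlyDistributedOn_cylinderMeasure :
    UniformlyDistributedOn (cylinderMeasure W) (cylinder W) := by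
  refine .of_transitive ?_ fun x hx y hy => ?_
  · rw [cylinderMeasure_apply W (isClosed_cylinder W).isOpen_compl.measurableSet]
    refine measure_mono_null (fun y hy => ?_) measure_empty
    exact hy.1 (cylinderRetract_mem_cylinder W (norm_pos_iff.1 hy.2.1))
  · obtain ⟨g, hgx, hnorm, hcomm⟩ := exists_isometryEquiv_cylinder W hx hy
    refine ⟨g, g.isometry, ⟨g.continuous.measurable, ?_⟩, hgx⟩
    have hvol : MeasurePreserving g (volume : Measure V) volume := by
      rw [← InnerProductSpace.euclideanHausdorffMeasure_eq_volume]
      exact g.measurePreserving_euclideanHausdorffMeasure _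
    have hsolid := hvol.restrict_preimage (measurableSet_solidCylinder W)
    have hpre : g ⁻¹' solidCylinder W = solidCylinder W := by
      ext z
      simp only [solidCylinder, Set.mem_preimage, Set.mem_ofPred_eq, hnorm]
    rw [hpre] at hsolid
    calc (cylinderMeasure W).map g
        = (volume.restrict (solidCylinder W)).map (g ∘ cylinderRetract W) :=
          map_map g.continuous.measurable (measurable_cylinderRetract W)
      _ = (volume.restrict (solidCylinder W)).map (cylinderRetract W ∘ g) :=
          congrArg (Measure.map · _) (funext fun z => (hcomm z).symm)
      _ = cylinderMeasure W := by
          rw [← map_map (measurable_cylinderRetract W) hsolid.measurable, hsolid.map_eq,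
            cylinderMeasure]

instance isLocallyFiniteMeasure_cylinderMeasure : IsLocallyFiniteMeasure (cylinderMeasure W) := by
  refine ⟨fun x => ⟨closedBall x 1, closedBall_mem_nhds x one_pos, ?_⟩⟩
  rw [cylinderMeasure_apply W isClosed_closedBall.measurableSet]
  refine (measure_mono fun y hy => ?_).trans_lt
    (measure_closedBall_lt_top (x := (0 : V)) (r := ‖x‖ + 1 + 1))
  have hP : ‖W.starProjection y‖ ≤ ‖x‖ + 1 := by
    rw [← starProjection_cylinderRetract]
    exact (W.norm_starProjection_apply_le _).trans (norm_le_of_mem_closedBall hy.1)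
  rw [mem_closedBall_zero_iff, ← W.starProjection_add_starProjection_orthogonal y]
  exact norm_add_le_of_le hP hy.2.2

variable {W} in
theorem cylinderMeasure_ne_zero (hW : W ≠ ⊤) : cylinderMeasure W ≠ 0 := by
  obtain ⟨w, hw, hw0⟩ := Wᗮ.ne_bot_iff.1 (mt (orthogonal_eq_bot_iff (K := W)).1 hW)
  have hopen : IsOpen {y | ‖Wᗮ.starProjection y‖ ∈ Set.Ioo (0 : ℝ) 1} :=
    isOpen_Ioo.preimage Wᗮ.starProjection.continuous.norm
  have hmem : (2 * ‖w‖)⁻¹ • w ∈ {y | ‖Wᗮ.starProjection y‖ ∈ Set.Ioo (0 : ℝ) 1} := by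
    have hpos := norm_pos_iff.2 hw0
    have hhalf : ‖(2 * ‖w‖)⁻¹ • w‖ = 2⁻¹ := by
      rw [norm_smul, norm_inv, norm_mul, norm_norm, mul_inv, mul_assoc, inv_mul_cancel₀ hpos.ne',
        mul_one, Real.norm_two]
    rw [Set.mem_ofPred_eq, starProjection_eq_self_iff.2 (smul_mem _ _ hw), hhalf]
    norm_num
  refine measure_univ_ne_zero.1 ?_
  rw [cylinderMeasure_apply W .univ, Set.preimage_univ, Set.univ_inter]
  exact (hopen.measure_pos volume ⟨_, hmem⟩ |>.trans_le
    (measure_mono (Set.preimage_mono Set.Ioo_subset_Ioc_self))).ne'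

/-- Near a point `x` the cylinder is parametrized by `h ↦ cylinderRetract W (u + h)` for `h ⊥ u`,
where `u` is the projection of `x` to `Wᗮ`. -/
theorem exists_mem_nhds_euclideanHausdorffMeasure_inter_cylinder_lt_top {m : ℕ}
    (hdim : finrank ℝ V = m + 1) {x : V} (hx : x ∈ cylinder W) :
    ∃ U ∈ 𝓝 x, μHE[m] (U ∩ cylinder W) < ⊤ := by
  set u := Wᗮ.starProjection x
  have huW : u ∈ Wᗮ := starProjection_apply_mem _ _
  have hu1 : ‖u‖ = 1 := hx
  have hu0 : u ≠ 0 := norm_ne_zero_iff.1 (by simp [hu1])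
  have hux : inner ℝ u x = 1 := by
    rw [← inner_starProjection_of_mem huW, real_inner_self_eq_norm_sq, hu1, one_pow]
  let H := (ℝ ∙ u)ᗮ
  let z : V → V := fun y => W.starProjection y + (inner ℝ u y)⁻¹ • Wᗮ.starProjection y
  let f : H → V := fun h => cylinderRetract W (u + h)
  let g : V → H := fun y => H.orthogonalProjectionOnto (z y)
  have hug : ∀ y, 0 < inner ℝ u y → u + g y = z y := fun y hy => by
    have huH : u ∈ Hᗮ := le_orthogonal_orthogonal _ (mem_span_singleton_self u)
    have hproj := starProjection_add_of_mem
      (starProjection_add_inv_smul_sub_mem huW hu1 hy.ne') huH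
    rw [sub_add_cancel] at hproj
    exact add_eq_of_eq_sub' hproj
  have hf : ContDiffAt ℝ 1 f (g x) := by
    refine ContDiffAt.comp (g x) (contDiffAt_cylinderRetract W ?_)
      (contDiffAt_const.add H.subtypeL.contDiff.contDiffAt)
    rw [hug x (by simp [hux])]
    simp only [z, hux, inv_one, one_smul, starProjection_add_starProjection_orthogonal]
    exact hu0
  have hg : ContinuousAt g x := by
    have : inner ℝ u x ≠ 0 := by simp [hux]
    fun_prop (disch := assumption)
  obtain ⟨C, T, hT, hlip⟩ := hf.exists_lipschitzOnWith
  refine ⟨g ⁻¹' (T ∩ closedBall (g x) 1) ∩ {y | 0 < inner ℝ u y}, ?_, ?_⟩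
  · refine inter_mem (hg.preimage_mem_nhds (inter_mem hT (closedBall_mem_nhds _ one_pos))) ?_
    exact (isOpen_lt continuous_const (by fun_prop)).mem_nhds (by simp [hux])
  · have : Fact (finrank ℝ V = m + 1) := ⟨hdim⟩
    rw [← finrank_orthogonal_span_singleton (𝕜 := ℝ) (n := m) hu0]
    have himage := euclideanHausdorffMeasure_image_lt_top (d := finrank ℝ H)
      (hlip.mono (Set.inter_subset_left (t := closedBall (g x) 1))) (by
        rw [InnerProductSpace.euclideanHausdorffMeasure_eq_volume]
        exact measure_lt_top_of_subset Set.inter_subset_right measure_closedBall_lt_top.ne)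
    refine measure_lt_top_of_subset ?_ himage.ne
    rintro y ⟨⟨hyT, hy0⟩, hyW⟩
    exact ⟨g y, hyT, (congrArg (cylinderRetract W) (hug y hy0)).trans
      (cylinderRetract_starProjection_add_smul W hyW (inv_pos.2 hy0))⟩

theorem isLocallyFiniteMeasure_euclideanHausdorffMeasure_restrict_cylinder {m : ℕ}
    (hdim : finrank ℝ V = m + 1) :
    IsLocallyFiniteMeasure ((μHE[m] : Measure V).restrict (cylinder W)) := by
  refine ⟨fun x => ?_⟩
  simp only [FiniteAtFilter, restrict_apply' (isClosed_cylinder W).measurableSet]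
  by_cases hx : x ∈ cylinder W
  · exact exists_mem_nhds_euclideanHausdorffMeasure_inter_cylinder_lt_top W hdim hx
  · exact ⟨(cylinder W)ᶜ, (isClosed_cylinder W).isOpen_compl.mem_nhds hx, by simp⟩

theorem exists_euclideanHausdorffMeasure_restrict_cylinder_eq_smul {m : ℕ}
    (hdim : finrank ℝ V = m + 1) :
    ∃ c : ENNReal, c ≠ ⊤ ∧
      (μHE[m] : Measure V).restrict (cylinder W) = c • cylinderMeasure W := by
  rcases eq_or_ne W ⊤ with rfl | hW
  · exact ⟨0, ENNReal.zero_ne_top, by simp [cylinder]⟩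
  have := isLocallyFiniteMeasure_euclideanHausdorffMeasure_restrict_cylinder W hdim
  exact (uniformlyDistributedOn_euclideanHausdorffMeasure_restrict_cylinder W m).exists_eq_smul
    (uniformlyDistributedOn_cylinderMeasure W) (cylinderMeasure_ne_zero hW)

variable {W} in
theorem volume_add_of_subset {A N : Set V} (hA : A ⊆ W) (hN : N ⊆ Wᗮ) :
    volume (A + N) = μHE[finrank ℝ W] A * μHE[finrank ℝ Wᗮ] N := by
  have hpre : W.measurableEquivProd (0 : V) ⁻¹'
      ({a : W | (a : V) ∈ A} ×ˢ {w : Wᗮ | (w : V) ∈ N}) = A + N := by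
    ext y
    simp only [Set.mem_preimage, measurableEquivProd_apply, vsub_eq_sub, sub_zero, Set.mem_prod,
      Set.mem_ofPred_eq]
    exact (mem_add_iff_starProjection_mem hA hN).symm
  rw [← hausdorff_eq_euclideanHausdorffMeasure, ← hausdorff_eq_euclideanHausdorffMeasure,
    hausdorff_eq_volume_of_sub_mem (x := 0) (by simpa using fun a ha => hA ha),
    hausdorff_eq_volume_of_sub_mem (x := 0) (by simpa using fun a ha => hN ha)]
  simp only [zero_add]
  rw [← prod_prod, ← volume_eq_prod,
    ← (W.measurePreserving_measurableEquivProd (0 : V)).measure_preimage_equiv, hpre,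
    InnerProductSpace.euclideanHausdorffMeasure_eq_volume]

variable {W} in
theorem cylinderMeasure_add {A N : Set V} (hA : A ⊆ W) (hN : N ⊆ Wᗮ)
    (hcone : ∀ t : ℝ, 0 < t → ∀ w ∈ N, t • w ∈ N) (hAm : MeasurableSet A)
    (hNm : MeasurableSet N) :
    cylinderMeasure W (A + N ∩ sphere 0 1) =
      μHE[finrank ℝ W] A * μHE[finrank ℝ Wᗮ] ((N ∩ closedBall 0 1) \ {0}) := by
  have hpre : cylinderRetract W ⁻¹' (A + N ∩ sphere 0 1) ∩ solidCylinder W =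
      A + (N ∩ closedBall 0 1) \ {0} := by
    ext y
    simp only [Set.mem_inter_iff, Set.mem_preimage, Set.mem_sdiff, Set.mem_singleton_iff,
      mem_add_iff_starProjection_mem hA (Set.inter_subset_left.trans hN),
      mem_add_iff_starProjection_mem hA
        (Set.sdiff_subset.trans (Set.inter_subset_left.trans hN)), solidCylinder,
      starProjection_cylinderRetract, starProjection_orthogonal_cylinderRetract,
      mem_sphere_zero_iff_norm, mem_closedBall_zero_iff, Set.mem_ofPred_eq, Set.mem_Ioc,
      norm_pos_iff]
    constructor
    · rintro ⟨⟨hPy, hQy, -⟩, hQ0, hQ1⟩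
      have := hcone _ (norm_pos_iff.2 hQ0) _ hQy
      rw [smul_inv_smul₀ (norm_ne_zero_iff.2 hQ0)] at this
      exact ⟨hPy, ⟨this, hQ1⟩, hQ0⟩
    · rintro ⟨hPy, ⟨hQy, hQ1⟩, hQ0⟩
      exact ⟨⟨hPy, hcone _ (inv_pos.2 (norm_pos_iff.2 hQ0)) _ hQy,
        norm_smul_inv_norm (𝕜 := ℝ) hQ0⟩, hQ0, hQ1⟩
  rw [cylinderMeasure_apply W (measurableSet_add hA (Set.inter_subset_left.trans hN) hAm
    (hNm.inter isClosed_sphere.measurableSet)), hpre, volume_add_of_subset hA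
    (Set.sdiff_subset.trans (Set.inter_subset_left.trans hN))]

theorem exists_hausdorff_add_inter_sphere_eq {m : ℕ} (hdim : finrank ℝ V = m + 1) :
    ∃ c : ENNReal, c ≠ ⊤ ∧ ∀ (A N : Set V) (x : V), (∀ a ∈ A, a - x ∈ W) → N ⊆ Wᗮ →
      (∀ t : ℝ, 0 < t → ∀ w ∈ N, t • w ∈ N) → MeasurableSet A → MeasurableSet N →
      hausdorff m (A + N ∩ sphere 0 1) =
        c * (hausdorff (finrank ℝ W) A * hausdorff (finrank ℝ Wᗮ) (N ∩ closedBall 0 1)) := by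
  rcases eq_or_ne W ⊤ with rfl | hW
  · refine ⟨0, ENNReal.zero_ne_top, fun A N x _ hN _ _ _ => ?_⟩
    have hempty : N ∩ sphere 0 1 = ∅ := by
      refine Set.eq_empty_of_forall_notMem fun w hw => ?_
      have hw0 : w = 0 := by simpa using hN hw.1
      exact ne_zero_of_mem_unit_sphere ⟨w, hw.2⟩ hw0
    rw [hempty, Set.add_empty, measure_empty, zero_mul]
  obtain ⟨c, hc, hcyl⟩ := exists_euclideanHausdorffMeasure_restrict_cylinder_eq_smul W hdim
  have hd : finrank ℝ Wᗮ ≠ 0 := by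
    rwa [Ne, Submodule.finrank_eq_zero, orthogonal_eq_bot_iff]
  refine ⟨c, hc, fun A N x hA hN hcone hAm hNm => ?_⟩
  have hA' := neg_vadd_subset_of_sub_mem hA
  have hsub : (-x +ᵥ A) + N ∩ sphere 0 1 ⊆ cylinder W := by
    rintro _ ⟨a, ha, w, hw, rfl⟩
    rw [cylinder, Set.mem_ofPred_eq, starProjection_orthogonal_add_of_mem (hA' ha) (hN hw.1)]
    exact mem_sphere_zero_iff_norm.1 hw.2
  rw [← hausdorff_vadd m (-x), ← vadd_add_assoc, ← hausdorff_vadd _ (-x) A]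
  simp only [hausdorff_eq_euclideanHausdorffMeasure]
  rw [← measure_sdiff_null (euclideanHausdorffMeasure_singleton hd 0),
    ← cylinderMeasure_add hA' hN hcone (hAm.const_vadd _) hNm, ← smul_eq_mul, ← Measure.smul_apply,
    ← hcyl, restrict_apply' (isClosed_cylinder W).measurableSet, Set.inter_eq_left.2 hsub]

end Measure

end Cylinder

/-! ### Nearest points -/

section NearestPoint

variable {V : Type*} [NormedAddCommGroup V] [InnerProductSpace ℝ V] {P : Set V}

theorem exists_dist_eq_infDist (hP : IsComplete P) (hc : Convex ℝ P) (hne : P.Nonempty) (y : V) :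
    ∃ q ∈ P, dist y q = Metric.infDist y P := by
  obtain ⟨q, hq, hmin⟩ := exists_norm_eq_iInf_of_complete_convex hne hP hc y
  exact ⟨q, hq, by simpa only [Metric.infDist_eq_iInf, dist_eq_norm] using hmin⟩

theorem nearestPoint_mem (hP : IsComplete P) (hc : Convex ℝ P) (hne : P.Nonempty) (y : V) :
    nearestPoint P y ∈ P := by
  rw [nearestPoint, dif_pos (exists_dist_eq_infDist hP hc hne y)]
  exact (exists_dist_eq_infDist hP hc hne y).choose_spec.1

theorem dist_nearestPoint (hP : IsComplete P) (hc : Convex ℝ P) (hne : P.Nonempty) (y : V) :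
    dist y (nearestPoint P y) = Metric.infDist y P := by
  rw [nearestPoint, dif_pos (exists_dist_eq_infDist hP hc hne y)]
  exact (exists_dist_eq_infDist hP hc hne y).choose_spec.2

theorem inner_sub_nearestPoint_nonpos (hP : IsComplete P) (hc : Convex ℝ P) (y : V) {q : V}
    (hq : q ∈ P) : inner ℝ (y - nearestPoint P y) (q - nearestPoint P y) ≤ 0 := by
  refine (norm_eq_iInf_iff_real_inner_le_zero hc (nearestPoint_mem hP hc ⟨q, hq⟩ y)).1 ?_ q hq
  simpa only [Metric.infDist_eq_iInf, dist_eq_norm] using dist_nearestPoint hP hc ⟨q, hq⟩ y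

theorem nearestPoint_eq (hP : IsComplete P) (hc : Convex ℝ P) {p y : V} (hp : p ∈ P)
    (hinner : ∀ q ∈ P, inner ℝ (y - p) (q - p) ≤ 0) : nearestPoint P y = p := by
  have h₁ := inner_sub_nearestPoint_nonpos hP hc y hp
  have h₂ := hinner _ (nearestPoint_mem hP hc ⟨p, hp⟩ y)
  rw [← sub_eq_zero, ← real_inner_self_nonpos]
  calc inner ℝ (nearestPoint P y - p) (nearestPoint P y - p)
      = inner ℝ (y - p) (nearestPoint P y - p) +
          inner ℝ (y - nearestPoint P y) (p - nearestPoint P y) := by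
        simp only [inner_sub_left, inner_sub_right]; ring
    _ ≤ 0 := add_nonpos h₂ h₁

end NearestPoint

/-! ### Faces and normal cones -/

section Faces

open Set Metric Submodule Filter Topology
open scoped Pointwise

variable {V : Type*} [NormedAddCommGroup V] [InnerProductSpace ℝ V] {F G P : Set V}

/-- The nonempty exposed faces of `P`, of all dimensions. -/
def allFaces (P : Set V) : Set (Set V) := {F | F.Nonempty ∧ IsExposed ℝ P F}

/-- The outer unit normals of `P` along `F`. -/
def unitNormals (F P : Set V) : Set V := normalCone F P ∩ sphere 0 1

theorem finite_allFaces (s : Finset V) : (allFaces (convexHull ℝ (s : Set V))).Finite := by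
  have hP : IsCompact (convexHull ℝ (s : Set V)) := s.finite_toSet.isCompact_convexHull ℝ
  have hc : Convex ℝ (convexHull ℝ (s : Set V)) := convex_convexHull ℝ _
  refine Set.Finite.of_finite_image (f := fun F : Set V => F.extremePoints ℝ)
    (s.finite_toSet.finite_subsets.subset ?_) ?_
  · rintro _ ⟨F, hF, rfl⟩
    exact hF.2.isExtreme.extremePoints_subset_extremePoints.trans extremePoints_convexHull_subset
  · intro F hF G hG hFG
    rw [← closure_convexHull_extremePoints (hF.2.isCompact hP) (hF.2.convex hc),
      ← closure_convexHull_extremePoints (hG.2.isCompact hP) (hG.2.convex hc)]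
    exact congrArg (fun A => closure (convexHull ℝ A)) hFG

theorem convex_normalCone (F P : Set V) : Convex ℝ (normalCone F P) := by
  intro w hw w' hw' a b ha hb _ p hp q hq
  rw [inner_add_left, real_inner_smul_left, real_inner_smul_left]
  exact add_nonpos (mul_nonpos_of_nonneg_of_nonpos ha (hw p hp q hq))
    (mul_nonpos_of_nonneg_of_nonpos hb (hw' p hp q hq))

theorem isClosed_normalCone (F P : Set V) : IsClosed (normalCone F P) := by
  simp only [normalCone, ofPred_forall]
  exact isClosed_biInter fun p _ => isClosed_biInter fun q _ =>
    isClosed_le (continuous_id.inner continuous_const) continuous_const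

theorem smul_mem_normalCone {w : V} {t : ℝ} (ht : 0 ≤ t) (hw : w ∈ normalCone F P) :
    t • w ∈ normalCone F P := fun p hp q hq => by
  rw [real_inner_smul_left]
  exact mul_nonpos_of_nonneg_of_nonpos ht (hw p hp q hq)

theorem normalCone_self (P : Set V) : normalCone P P = (vectorSpan ℝ P)ᗮ := by
  refine Subset.antisymm (fun w hw => ?_) fun w hw p hp q hq =>
    ((mem_orthogonal' _ _).1 hw _ (vsub_mem_vectorSpan ℝ hq hp)).le
  have hspan : vectorSpan ℝ P ≤ (innerₛₗ ℝ w).ker := by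
    rw [vectorSpan_def, span_le]
    rintro _ ⟨q, hq, p, hp, rfl⟩
    refine (hw p hp q hq).antisymm ?_
    simpa only [inner_sub_right, sub_nonneg, sub_nonpos] using hw q hq p hp
  exact (mem_orthogonal' _ _).2 fun u hu => hspan hu

theorem normalCone_subset_orthogonal (hFP : F ⊆ P) : normalCone F P ⊆ (vectorSpan ℝ F)ᗮ := by
  rw [← normalCone_self]
  exact fun w hw p hp q hq => hw p hp q (hFP hq)

theorem nearestPoint_add_of_mem_normalCone (hP : IsComplete P) (hc : Convex ℝ P) (hFP : F ⊆ P)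
    {p u : V} (hp : p ∈ F) (hu : u ∈ normalCone F P) : nearestPoint P (p + u) = p :=
  nearestPoint_eq hP hc (hFP hp) fun q hq => by simpa using hu p hp q hq

theorem normalMap_add_of_mem_normalCone (hP : IsComplete P) (hc : Convex ℝ P) (hFP : F ⊆ P)
    {p u : V} (hp : p ∈ F) (hu : u ∈ normalCone F P) : normalMap P (p + u) = (p, ‖u‖⁻¹ • u) := by
  rw [normalMap, nearestPoint_add_of_mem_normalCone hP hc hFP hp hu, add_sub_cancel_left]

theorem exists_mem_allFaces_sub_nearestPoint_mem_normalCone (hP : IsComplete P) (hc : Convex ℝ P)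
    (hne : P.Nonempty) (y : V) :
    ∃ F ∈ allFaces P, nearestPoint P y ∈ F ∧ y - nearestPoint P y ∈ normalCone F P := by
  have hinner := fun q hq => inner_sub_nearestPoint_nonpos hP hc y (q := q) hq
  set p := nearestPoint P y
  have hp : p ∈ (innerSL ℝ (y - p)).toExposed P := by
    refine ⟨nearestPoint_mem hP hc hne y, fun q hq => ?_⟩
    simpa only [innerSL_apply_apply, inner_sub_right, sub_nonpos] using hinner q hq
  refine ⟨_, ⟨⟨p, hp⟩, ContinuousLinearMap.toExposed.isExposed⟩, hp, fun q hq r hr => ?_⟩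
  simpa only [innerSL_apply_apply, inner_sub_right, sub_nonpos] using hq.2 r hr

theorem setOf_infDist_eq_one_and_normalMap_mem (hP : IsComplete P) (hc : Convex ℝ P)
    (hne : P.Nonempty) (E : Set V) :
    {y | infDist y P = 1 ∧ (normalMap P y).1 ∈ E} =
      ⋃ F : allFaces P, (F : Set V) ∩ E + unitNormals (F : Set V) P := by
  ext y
  simp only [mem_ofPred_eq, mem_iUnion, Subtype.exists, exists_prop]
  constructor
  · rintro ⟨hy, hE⟩
    obtain ⟨F, hF, hp, hu⟩ := exists_mem_allFaces_sub_nearestPoint_mem_normalCone hP hc hne y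
    refine ⟨F, hF, _, ⟨hp, hE⟩, _, ⟨hu, ?_⟩, add_sub_cancel _ _⟩
    rw [mem_sphere_zero_iff_norm, ← dist_eq_norm, dist_nearestPoint hP hc hne, hy]
  · rintro ⟨F, hF, p, ⟨hp, hE⟩, u, ⟨hu, hu1⟩, rfl⟩
    have hnear := nearestPoint_add_of_mem_normalCone hP hc hF.2.subset hp hu
    refine ⟨?_, (congrArg (· ∈ E) hnear).mpr hE⟩
    rw [← dist_nearestPoint hP hc hne, hnear, dist_eq_norm, add_sub_cancel_left]
    exact mem_sphere_zero_iff_norm.1 hu1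

/-- The interior of `S` relative to the translates of `U`. -/
def relInterior (U : Submodule ℝ V) (S : Set V) : Set V := {x | ∀ᶠ a : U in 𝓝 0, x + (a : V) ∈ S}

theorem relInterior_subset (U : Submodule ℝ V) (S : Set V) : relInterior U S ⊆ S := fun x hx => by
  simpa using hx.self_of_nhds

theorem smul_mem_relInterior {U : Submodule ℝ V} {S : Set V} {t : ℝ} (ht : t ≠ 0)
    (hS : ∀ x ∈ S, t • x ∈ S) {x : V} (hx : x ∈ relInterior U S) : t • x ∈ relInterior U S := by
  have hcont : Tendsto (fun a : U => t⁻¹ • a) (𝓝 0) (𝓝 0) := by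
    simpa using (continuous_const_smul t⁻¹).tendsto (0 : U)
  filter_upwards [hcont.eventually hx] with a ha
  have := hS _ ha
  rwa [smul_add, coe_smul, smul_inv_smul₀ ht] at this

theorem setOf_add_mem_sdiff_relInterior (U : Submodule ℝ V) {S : Set V} (hS : IsClosed S) (x : V) :
    {a : U | x + (a : V) ∈ S \ relInterior U S} = frontier {a : U | x + (a : V) ∈ S} := by
  have hcl : IsClosed {a : U | x + (a : V) ∈ S} :=
    hS.preimage (continuous_const.add continuous_subtype_val)
  ext a
  rw [hcl.frontier_eq, Set.mem_sdiff, mem_interior_iff_mem_nhds, ← eventually_mem_set,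
    ← map_add_left_nhds_zero, eventually_map]
  simp only [relInterior, mem_ofPred_eq, Set.mem_sdiff, coe_add, add_assoc]

theorem subset_of_mem_relInterior_of_mem (hFP : F ⊆ P) (hG : IsExposed ℝ P G) {p : V}
    (hpF : p ∈ relInterior (vectorSpan ℝ F) F) (hpG : p ∈ G) : F ⊆ G := by
  intro x hx
  let d : vectorSpan ℝ F := ⟨p - x, vsub_mem_vectorSpan ℝ (relInterior_subset _ _ hpF) hx⟩
  have hcont : Tendsto (fun t : ℝ => t • d) (𝓝[>] 0) (𝓝 0) := by
    have : Continuous fun t : ℝ => t • d := by fun_prop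
    simpa using (this.tendsto 0).mono_left nhdsWithin_le_nhds
  obtain ⟨t, hmem, ht⟩ := ((hcont.eventually hpF).and self_mem_nhdsWithin).exists
  refine hG.isExtreme.left_mem_of_mem_openSegment (hFP hx) (hFP hmem) hpG ?_
  replace ht : 0 < t := ht
  refine ⟨t / (1 + t), 1 / (1 + t), by positivity, by positivity, by field_simp; ring, ?_⟩
  simp only [d, coe_smul]
  match_scalars
  · field_simp
    ring
  · field_simp

end Faces

/-! ### The parallel hypersurface of a polytope -/

section ParallelHypersurface

open Set Metric Submodule Filter Topology MeasureTheory
open scoped Pointwise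

variable {V : Type*} [NormedAddCommGroup V] [InnerProductSpace ℝ V]

theorem hasFDerivAt_normalize {q : V} (hq : ‖q‖ = 1) :
    HasFDerivAt (fun z : V => ‖z‖⁻¹ • z)
      (ContinuousLinearMap.id ℝ V - (innerSL ℝ q).smulRight q) q := by
  have hnorm : HasFDerivAt (fun z : V => ‖z‖) (innerSL ℝ q) q := by
    have hsqrt := (hasFDerivAt_id (𝕜 := ℝ) q).norm_sq.sqrt (by simp [hq])
    simp only [id_eq, Real.sqrt_sq (norm_nonneg _), hq] at hsqrt
    convert hsqrt using 1
    ext v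
    simp
  have hinv := (hasDerivAt_inv (x := ‖q‖) (by simp [hq])).comp_hasFDerivAt q hnorm
  refine (hinv.smul (hasFDerivAt_id q)).congr_fderiv (ContinuousLinearMap.ext fun v => ?_)
  simp [hq, sub_eq_add_neg]

variable {F G P : Set V}

/-- The part of the parallel hypersurface of `P` over the face `F` at which the normal map is
differentiable: the sums of a relatively interior point of `F` and a relatively interior unit
vector of the normal cone. -/
def openPiece (F P : Set V) : Set V :=
  relInterior (vectorSpan ℝ F) F + relInterior (vectorSpan ℝ F)ᗮ (normalCone F P) ∩ sphere 0 1

theorem disjoint_openPiece (hP : IsComplete P) (hc : Convex ℝ P) (hF : IsExposed ℝ P F)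
    (hG : IsExposed ℝ P G) (hFG : F ≠ G) : Disjoint (openPiece F P) (openPiece G P) := by
  refine Set.disjoint_left.2 ?_
  rintro _ ⟨p, hp, u, ⟨hu, -⟩, rfl⟩ ⟨q, hq, v, ⟨hv, -⟩, hqv⟩
  have hpu := nearestPoint_add_of_mem_normalCone hP hc hF.subset (relInterior_subset _ _ hp)
    (relInterior_subset _ _ hu)
  have hqv' := nearestPoint_add_of_mem_normalCone hP hc hG.subset (relInterior_subset _ _ hq)
    (relInterior_subset _ _ hv)
  obtain rfl : p = q := hpu.symm.trans ((congrArg (nearestPoint P) hqv.symm).trans hqv')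
  exact hFG ((subset_of_mem_relInterior_of_mem hF.subset hG hp (relInterior_subset _ _ hq)).antisymm
    (subset_of_mem_relInterior_of_mem hG.subset hF hq (relInterior_subset _ _ hp)))

variable [FiniteDimensional ℝ V]

theorem eventually_normalMap_eq (hP : IsComplete P) (hc : Convex ℝ P) (hFP : F ⊆ P) {p u : V}
    (hp : p ∈ relInterior (vectorSpan ℝ F) F)
    (hu : u ∈ relInterior (vectorSpan ℝ F)ᗮ (normalCone F P)) :
    ∀ᶠ z in 𝓝 (p + u), normalMap P z =
      (p + (vectorSpan ℝ F).starProjection (z - (p + u)),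
        ‖u + (vectorSpan ℝ F)ᗮ.starProjection (z - (p + u))‖⁻¹ •
          (u + (vectorSpan ℝ F)ᗮ.starProjection (z - (p + u)))) := by
  have hproj : ∀ W : Submodule ℝ V,
      Tendsto (fun z => W.orthogonalProjectionOnto (z - (p + u))) (𝓝 (p + u)) (𝓝 0) := fun W => by
    have : Continuous fun z => W.orthogonalProjectionOnto (z - (p + u)) := by fun_prop
    simpa using this.tendsto (p + u)
  filter_upwards [(hproj _).eventually hp, (hproj _).eventually hu] with z hz₁ hz₂
  have hz := normalMap_add_of_mem_normalCone hP hc hFP hz₁ hz₂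
  rwa [add_add_add_comm, ← starProjection_apply, ← starProjection_apply,
    starProjection_add_starProjection_orthogonal, add_sub_cancel] at hz

theorem fderiv_normalMap (hP : IsComplete P) (hc : Convex ℝ P) (hFP : F ⊆ P) {p u v : V}
    (hp : p ∈ relInterior (vectorSpan ℝ F) F)
    (hu : u ∈ relInterior (vectorSpan ℝ F)ᗮ (normalCone F P)) (hu1 : ‖u‖ = 1)
    (huv : inner ℝ u v = 0) :
    fderiv ℝ (normalMap P) (p + u) v =
      ((vectorSpan ℝ F).starProjection v, (vectorSpan ℝ F)ᗮ.starProjection v) := by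
  set W := vectorSpan ℝ F
  have hsub : HasFDerivAt (fun z : V => z - (p + u)) (ContinuousLinearMap.id ℝ V) (p + u) :=
    (hasFDerivAt_id _).sub_const _
  have hfst : HasFDerivAt (fun z : V => p + W.starProjection (z - (p + u))) W.starProjection
      (p + u) := (W.starProjection.hasFDerivAt.comp _ hsub).const_add p
  have hsnd : HasFDerivAt (fun z : V => u + Wᗮ.starProjection (z - (p + u))) Wᗮ.starProjection
      (p + u) := (Wᗮ.starProjection.hasFDerivAt.comp _ hsub).const_add u
  have hnormalize := (hasFDerivAt_normalize (q := u + Wᗮ.starProjection (p + u - (p + u)))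
    (by simpa using hu1)).comp (p + u) hsnd
  have huW : u ∈ Wᗮ := normalCone_subset_orthogonal hFP (relInterior_subset _ _ hu)
  have huv' : inner ℝ u (Wᗮ.starProjection v) = 0 := by rw [inner_starProjection_of_mem huW, huv]
  rw [((hfst.prodMk hnormalize).congr_of_eventuallyEq
    (eventually_normalMap_eq hP hc hFP hp hu)).fderiv]
  simp [-starProjection_orthogonal_val, huv']

theorem isClosed_sdiff_relInterior {U : Submodule ℝ V} {S : Set V} {x : V}
    (hS : ∀ y ∈ S, y - x ∈ U) (hcl : IsClosed S) : IsClosed (S \ relInterior U S) := by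
  rw [← vadd_image_coe_eq fun y (hy : y ∈ S \ relInterior U S) => hS y hy.1,
    setOf_add_mem_sdiff_relInterior U hcl]
  exact (U.closed_of_finiteDimensional.isClosedEmbedding_subtypeVal.isClosedMap _
    isClosed_frontier).vadd x

variable [MeasurableSpace V] [BorelSpace V]

theorem hausdorff_sdiff_relInterior {U : Submodule ℝ V} {S : Set V} {x : V}
    (hS : ∀ y ∈ S, y - x ∈ U) (hcl : IsClosed S) (hc : Convex ℝ S) :
    hausdorff (Module.finrank ℝ U) (S \ relInterior U S) = 0 := by
  have hc' : Convex ℝ {a : U | x + (a : V) ∈ S} :=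
    (hc.translate_preimage_right x).linear_preimage U.subtype
  rw [hausdorff_eq_volume_of_sub_mem fun y hy => hS y hy.1,
    setOf_add_mem_sdiff_relInterior U hcl, hc'.addHaar_frontier volume]

theorem hausdorff_add_inter_sphere_sdiff_relInterior {m : ℕ} (hdim : Module.finrank ℝ V = m + 1)
    {W : Submodule ℝ V} {A N : Set V} {x : V} (hAW : ∀ a ∈ A, a - x ∈ W) (hA : IsClosed A)
    (hAc : Convex ℝ A) (hNW : N ⊆ Wᗮ) (hN : IsClosed N) (hNc : Convex ℝ N)
    (hcone : ∀ t : ℝ, 0 < t → ∀ w ∈ N, t • w ∈ N) :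
    hausdorff m ((A + N ∩ sphere 0 1) \ (relInterior W A + relInterior Wᗮ N ∩ sphere 0 1)) = 0 := by
  obtain ⟨c, -, hprod⟩ := exists_hausdorff_add_inter_sphere_eq W hdim
  have hNW' : ∀ w ∈ N, w - 0 ∈ Wᗮ := fun w hw => by simpa using hNW hw
  have hcone' : ∀ t : ℝ, 0 < t → ∀ w ∈ N \ relInterior Wᗮ N, t • w ∈ N \ relInterior Wᗮ N := by
    refine fun t ht w hw => ⟨hcone t ht w hw.1, fun htw => hw.2 ?_⟩
    simpa only [inv_smul_smul₀ ht.ne'] using smul_mem_relInterior (inv_ne_zero ht.ne')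
      (hcone _ (inv_pos.2 ht)) htw
  have hleft : hausdorff m (A \ relInterior W A + N ∩ sphere 0 1) = 0 := by
    rw [hprod _ _ x (fun a ha => hAW a ha.1) hNW hcone
      (isClosed_sdiff_relInterior hAW hA).measurableSet hN.measurableSet,
      hausdorff_sdiff_relInterior hAW hA hAc, zero_mul, mul_zero]
  have hright : hausdorff m (A + (N \ relInterior Wᗮ N) ∩ sphere 0 1) = 0 := by
    rw [hprod _ _ x hAW (sdiff_subset.trans hNW) hcone' hA.measurableSet
      (isClosed_sdiff_relInterior hNW' hN).measurableSet,
      measure_mono_null inter_subset_left (hausdorff_sdiff_relInterior hNW' hN hNc), mul_zero,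
      mul_zero]
  refine measure_mono_null ?_ (measure_union_null hleft hright)
  rintro _ ⟨⟨a, ha, w, ⟨hw, hw1⟩, rfl⟩, hnot⟩
  by_cases ha' : a ∈ relInterior W A
  · exact Or.inr ⟨a, ha, w, ⟨⟨hw, fun hw' => hnot ⟨a, ha', w, ⟨hw', hw1⟩, rfl⟩⟩, hw1⟩, rfl⟩
  · exact Or.inl ⟨a, ⟨ha, ha'⟩, w, ⟨hw, hw1⟩, rfl⟩

theorem hausdorff_add_unitNormals_sdiff_openPiece {m : ℕ} (hdim : Module.finrank ℝ V = m + 1)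
    (hP : IsCompact P) (hc : Convex ℝ P) (hF : F ∈ allFaces P) :
    hausdorff m ((F + unitNormals F P) \ openPiece F P) = 0 := by
  obtain ⟨⟨x, hx⟩, hF⟩ := hF
  exact hausdorff_add_inter_sphere_sdiff_relInterior hdim
    (fun a ha => vsub_mem_vectorSpan ℝ ha hx) (hF.isCompact hP).isClosed (hF.convex hc)
    (normalCone_subset_orthogonal hF.subset) (isClosed_normalCone F P) (convex_normalCone F P)
    fun t ht w hw => smul_mem_normalCone ht.le hw

theorem aedisjoint_add_unitNormals {m : ℕ} (hdim : Module.finrank ℝ V = m + 1)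
    (hP : IsCompact P) (hc : Convex ℝ P) (hF : F ∈ allFaces P) (hG : G ∈ allFaces P)
    (hFG : F ≠ G) : AEDisjoint (hausdorff m) (F + unitNormals F P) (G + unitNormals G P) := by
  refine measure_mono_null ?_ (measure_union_null
    (hausdorff_add_unitNormals_sdiff_openPiece hdim hP hc hF)
    (hausdorff_add_unitNormals_sdiff_openPiece hdim hP hc hG))
  refine fun y hy => or_iff_not_imp_left.2 fun hyF => ⟨hy.2, fun hyG => ?_⟩
  refine Set.disjoint_left.1 (disjoint_openPiece hP.isComplete hc hF.2 hG.2 hFG) ?_ hyG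
  exact not_not.1 fun h => hyF ⟨hy.1, h⟩

theorem measurableSet_inter_add_unitNormals (hP : IsCompact P) (hF : F ∈ allFaces P) {E : Set V}
    (hE : MeasurableSet E) : MeasurableSet (F ∩ E + unitNormals F P) := by
  obtain ⟨⟨x, hx⟩, hF⟩ := hF
  exact measurableSet_add_of_sub_mem (fun a ha => vsub_mem_vectorSpan ℝ ha.1 hx)
    (inter_subset_left.trans (normalCone_subset_orthogonal hF.subset))
    ((hF.isCompact hP).measurableSet.inter hE)
    ((isClosed_normalCone F P).inter isClosed_sphere).measurableSet

theorem toReal_hausdorff_inter_closedBall_ne_zero (U : Submodule ℝ V) :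
    (hausdorff (Module.finrank ℝ U) ((U : Set V) ∩ closedBall 0 1)).toReal ≠ 0 := by
  have hU : ∀ a ∈ (U : Set V) ∩ closedBall 0 1, a - 0 ∈ U := fun a ha => by simpa using ha.1
  have hball : {a : U | 0 + (a : V) ∈ (U : Set V) ∩ closedBall 0 1} = closedBall 0 1 := by
    ext a
    simp
  rw [hausdorff_eq_volume_of_sub_mem hU, hball]
  exact ENNReal.toReal_ne_zero.2 ⟨(measure_closedBall_pos _ _ one_pos).ne',
    measure_closedBall_lt_top.ne⟩

theorem exists_hausdorff_inter_add_unitNormals_eq {m : ℕ} (hdim : Module.finrank ℝ V = m + 1)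
    (W : Submodule ℝ V) :
    ∃ κ : ℝ, ∀ P F E : Set V, IsCompact P → F ∈ allFaces P → vectorSpan ℝ F = W →
      MeasurableSet E → hausdorff m (F ∩ E + unitNormals F P) < ⊤ ∧
        (hausdorff m (F ∩ E + unitNormals F P)).toReal =
          κ * exteriorAngle F P * (hausdorff (Module.finrank ℝ W) (F ∩ E)).toReal := by
  obtain ⟨c, hc, hprod⟩ := exists_hausdorff_add_inter_sphere_eq W hdim
  refine ⟨c.toReal * (hausdorff (Module.finrank ℝ Wᗮ) ((Wᗮ : Set V) ∩ closedBall 0 1)).toReal, ?_⟩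
  rintro P F E hP ⟨⟨x, hx⟩, hF⟩ rfl hE
  have hFx : ∀ a ∈ F ∩ E, a - x ∈ vectorSpan ℝ F := fun a ha => vsub_mem_vectorSpan ℝ ha.1 hx
  have hN : ∀ w ∈ normalCone F P ∩ closedBall 0 1, w - 0 ∈ (vectorSpan ℝ F)ᗮ := fun w hw => by
    simpa using normalCone_subset_orthogonal hF.subset hw.1
  have hFm := (hF.isCompact hP).measurableSet.inter hE
  have hFfin := hausdorff_lt_top_of_isBounded hFx
    ((hF.isCompact hP).isBounded.subset inter_subset_left)
  have hNfin := hausdorff_lt_top_of_isBounded hN (isBounded_closedBall.subset inter_subset_right)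
  rw [unitNormals, hprod _ _ x hFx (normalCone_subset_orthogonal hF.subset)
    (fun t ht w hw => smul_mem_normalCone ht.le hw) hFm (isClosed_normalCone F P).measurableSet]
  refine ⟨ENNReal.mul_lt_top hc.lt_top (ENNReal.mul_lt_top hFfin hNfin), ?_⟩
  have hball := toReal_hausdorff_inter_closedBall_ne_zero (vectorSpan ℝ F)ᗮ
  simp only [exteriorAngle, ENNReal.toReal_mul]
  field_simp

theorem exteriorAngle_self (P : Set V) : exteriorAngle P P = 1 := by
  rw [exteriorAngle, normalCone_self]
  exact div_self (toReal_hausdorff_inter_closedBall_ne_zero _)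

end ParallelHypersurface

/-! ### A criterion for angularity -/

section Criterion

open Set Metric Submodule Filter Topology MeasureTheory
open scoped Pointwise

variable {V : Type*} [NormedAddCommGroup V] [InnerProductSpace ℝ V] {m : ℕ}

theorem adaptedFrameValue_congr (o : Orientation ℝ V (Fin (m + 1))) {u : V} {A : Type*}
    [AddCommGroup A] [Module ℝ A] {S T : OrthonormalBasis (Fin (m + 1)) ℝ V → A}
    (h : ∀ b : OrthonormalBasis (Fin (m + 1)) ℝ V, b 0 = u → S b = T b) :
    adaptedFrameValue o u S = adaptedFrameValue o u T := by
  unfold adaptedFrameValue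
  split_ifs with hb
  · rw [h _ hb.choose_spec]
  · rfl

theorem eq_of_isExposed_of_vectorSpan_eq {F P : Set V} (hF : IsExposed ℝ P F) (hne : F.Nonempty)
    (hspan : vectorSpan ℝ F = vectorSpan ℝ P) : F = P := by
  obtain ⟨l, rfl⟩ := hF hne
  obtain ⟨p, hp⟩ := hne
  have hker : vectorSpan ℝ P ≤ (l : V →ₗ[ℝ] ℝ).ker := by
    rw [← hspan, vectorSpan_def, span_le]
    rintro _ ⟨x, hx, y, hy, rfl⟩
    simpa [sub_eq_zero] using (hy.2 x hx.1).antisymm (hx.2 y hy.1)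
  refine Subset.antisymm hF.subset fun x hx => ⟨hx, fun y hy => ?_⟩
  have hxp : l (x - p) = 0 := hker (vsub_mem_vectorSpan ℝ hx hp.1)
  rw [map_sub, sub_eq_zero] at hxp
  exact hxp ▸ hp.2 y hy

variable [FiniteDimensional ℝ V]

/-- The value of the form `ψ` on the normal cycle of a polytope at a unit normal `u` along a face
with direction `W`. -/
def faceValue (o : Orientation ℝ V (Fin (m + 1))) (ψ : V → (V × V) [⋀^Fin m]→ₗ[ℝ] ℝ)
    (W : Submodule ℝ V) (u : V) : ℝ :=
  adaptedFrameValue o u fun b =>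
    ψ u fun i : Fin m => (W.starProjection (b i.succ), Wᗮ.starProjection (b i.succ))

/-- The integrand of `integralNormalCycle`: the pullback of `ψ` to the parallel hypersurface of
`P`, as a density. -/
def normalCycleDensity (o : Orientation ℝ V (Fin (m + 1))) (ψ : V → (V × V) [⋀^Fin m]→ₗ[ℝ] ℝ)
    (P : Set V) (y : V) : ℝ :=
  adaptedFrameValue o (normalMap P y).2 fun b =>
    ψ (normalMap P y).2 fun i : Fin m => fderiv ℝ (normalMap P) y (b i.succ)

variable {F P : Set V} {o : Orientation ℝ V (Fin (m + 1))}
  {ψ : V → (V × V) [⋀^Fin m]→ₗ[ℝ] ℝ}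

theorem normalCycleDensity_add (hP : IsComplete P) (hc : Convex ℝ P) (hFP : F ⊆ P) {p u : V}
    (hp : p ∈ relInterior (vectorSpan ℝ F) F)
    (hu : u ∈ relInterior (vectorSpan ℝ F)ᗮ (normalCone F P)) (hu1 : ‖u‖ = 1) :
    normalCycleDensity o ψ P (p + u) = faceValue o ψ (vectorSpan ℝ F) u := by
  rw [normalCycleDensity, normalMap_add_of_mem_normalCone hP hc hFP (relInterior_subset _ _ hp)
    (relInterior_subset _ _ hu), hu1, inv_one, one_smul]
  refine adaptedFrameValue_congr o fun b (hb : b 0 = u) => congrArg (ψ u) (funext fun i => ?_)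
  refine fderiv_normalMap hP hc hFP hp hu hu1 ?_
  rw [← hb]
  exact b.orthonormal.2 (Fin.succ_ne_zero i).symm

theorem finsum_faces_eq_finsum_allFaces (hfin : (allFaces P).Finite) (f : ℕ → Set V → ℝ) :
    ∑ k ∈ Finset.range (Module.finrank ℝ V + 1), ∑ᶠ F ∈ faces P k, f k F =
      ∑ᶠ F ∈ allFaces P, f (Module.finrank ℝ (vectorSpan ℝ F)) F := by
  have hfaces : ⋃ k ∈ (Finset.range (Module.finrank ℝ V + 1) : Set ℕ), faces P k = allFaces P := by
    ext F
    simp [faces, allFaces, Submodule.finrank_le]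
  have hdisj : (Finset.range (Module.finrank ℝ V + 1) : Set ℕ).PairwiseDisjoint (faces P) :=
    fun i _ j _ hij => Set.disjoint_left.2 fun F hi hj => hij (hi.2.2.symm.trans hj.2.2)
  rw [← hfaces, finsum_mem_biUnion hdisj (Finset.finite_toSet _), finsum_mem_coe_finset]
  · exact Finset.sum_congr rfl fun k _ => finsum_mem_congr rfl fun F hF => by rw [hF.2.2]
  · exact fun k _ => hfin.subset fun F hF => ⟨hF.1, hF.2.1⟩

variable [MeasurableSpace V] [BorelSpace V]

theorem ae_normalCycleDensity_eq (hdim : Module.finrank ℝ V = m + 1) (hP : IsCompact P)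
    (hc : Convex ℝ P) (hF : F ∈ allFaces P) {E : Set V} (hE : MeasurableSet E) {c : ℝ}
    (hψ : ∀ u ∈ (vectorSpan ℝ F)ᗮ, ‖u‖ = 1 → faceValue o ψ (vectorSpan ℝ F) u = c) :
    ∀ᵐ y ∂(hausdorff m).restrict (F ∩ E + unitNormals F P), normalCycleDensity o ψ P y = c := by
  rw [ae_restrict_iff' (measurableSet_inter_add_unitNormals hP hF hE)]
  refine measure_mono_null (fun y hy => ?_)
    (hausdorff_add_unitNormals_sdiff_openPiece hdim hP hc hF)
  simp only [mem_compl_iff, mem_ofPred_eq, Classical.not_imp] at hy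
  refine ⟨add_subset_add_right inter_subset_left hy.1, ?_⟩
  rintro ⟨p, hp, u, ⟨hu, hu1⟩, rfl⟩
  rw [mem_sphere_zero_iff_norm] at hu1
  exact hy.2 ((normalCycleDensity_add hP.isComplete hc hF.2.subset hp hu hu1).trans
    (hψ u (normalCone_subset_orthogonal hF.2.subset (relInterior_subset _ _ hu)) hu1))

theorem integralNormalCycle_eq_finsum (hdim : Module.finrank ℝ V = m + 1) (hP : IsCompact P)
    (hc : Convex ℝ P) (hne : P.Nonempty) (hfin : (allFaces P).Finite) {E : Set V}
    (hE : MeasurableSet E) {c : Submodule ℝ V → ℝ}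
    (hψ : ∀ W : Submodule ℝ V, ∀ u ∈ Wᗮ, ‖u‖ = 1 → faceValue o ψ W u = c W) :
    integralNormalCycle o ψ P E = ∑ᶠ F ∈ allFaces P,
      c (vectorSpan ℝ F) * (hausdorff m (F ∩ E + unitNormals F P)).toReal := by
  have := hfin.fintype
  have hae (F : allFaces P) :=
    ae_normalCycleDensity_eq hdim hP hc F.2 hE (hψ (vectorSpan ℝ (F : Set V)))
  change ∫ y in _, normalCycleDensity o ψ P y ∂_ = _
  rw [setOf_infDist_eq_one_and_normalMap_mem hP.isComplete hc hne, integral_iUnion_ae, tsum_fintype,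
    ← finsum_set_coe_eq_finsum_mem, finsum_eq_sum_of_fintype]
  · refine Finset.sum_congr rfl fun F _ => ?_
    rw [integral_congr_ae (hae F), integral_const, smul_eq_mul, mul_comm,
      measureReal_restrict_apply_univ]
    rfl
  · exact fun F => (measurableSet_inter_add_unitNormals hP F.2 hE).nullMeasurableSet
  · exact fun F G hFG => (aedisjoint_add_unitNormals hdim hP hc F.2 G.2
      (Subtype.coe_injective.ne hFG)).mono (add_subset_add_right inter_subset_left)
        (add_subset_add_right inter_subset_left)
  · refine integrableOn_finite_iUnion.2 fun F => ?_
    obtain ⟨κ, hκ⟩ := exists_hausdorff_inter_add_unitNormals_eq hdim (vectorSpan ℝ (F : Set V))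
    have hlt := (hκ P F E hP F.2 rfl hE).1
    exact (integrable_congr (hae F)).2 (integrableOn_const hlt.ne)

theorem volume_eq_zero_of_vectorSpan_ne_top (h : vectorSpan ℝ P ≠ ⊤) : volume P = 0 := by
  refine measure_mono_null (subset_affineSpan ℝ P)
    (Measure.addHaar_affineSubspace _ _ fun htop => h ?_)
  rw [← direction_affineSpan, htop, AffineSubspace.direction_top]

open Classical in
theorem toReal_volume_inter_eq_finsum (hne : P.Nonempty) (E : Set V) :
    (volume (P ∩ E)).toReal = ∑ᶠ F ∈ allFaces P,
      (if vectorSpan ℝ F = ⊤ then 1 else 0) * exteriorAngle F P *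
        (hausdorff (Module.finrank ℝ (vectorSpan ℝ F)) (F ∩ E)).toReal := by
  have hPP : P ∈ allFaces P := ⟨hne, IsExposed.refl P⟩
  have hproper {F : Set V} (hF : F ∈ allFaces P) (hFP : F ≠ P) : vectorSpan ℝ F ≠ ⊤ := fun h =>
    hFP (eq_of_isExposed_of_vectorSpan_eq hF.2 hF.1
      (h.trans (top_le_iff.1 (h ▸ vectorSpan_mono ℝ hF.2.subset)).symm))
  rw [finsum_mem_inter_support_eq' _ (allFaces P) {P}, finsum_mem_singleton, exteriorAngle_self,
    mul_one]
  · split_ifs with htop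
    · rw [htop, finrank_top, hausdorff_eq_euclideanHausdorffMeasure,
        InnerProductSpace.euclideanHausdorffMeasure_eq_volume, one_mul]
    · rw [measure_mono_null inter_subset_left (volume_eq_zero_of_vectorSpan_ne_top htop),
        ENNReal.toReal_zero, zero_mul]
  · intro F hF
    refine ⟨fun hFP => by_contra fun hne => hF ?_, fun hFP => hFP ▸ hPP⟩
    simp only [if_neg (hproper hFP hne), zero_mul]

open Classical in
theorem isAngular_of_faceValue_eq (hdim : Module.finrank ℝ V = m + 1) (Ψ : InvFormPair V m)
    (hΨ : ∀ W : Submodule ℝ V, ∀ u ∈ Wᗮ, ∀ v ∈ Wᗮ, ‖u‖ = 1 → ‖v‖ = 1 →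
      faceValue o Ψ.sphereForm W u = faceValue o Ψ.sphereForm W v) :
    Ψ.IsAngular o := by
  have (W : Submodule ℝ V) : ∃ c, ∀ u ∈ Wᗮ, ‖u‖ = 1 → faceValue o Ψ.sphereForm W u = c := by
    by_cases h : ∃ v ∈ Wᗮ, ‖v‖ = 1
    · obtain ⟨v, hv, hv1⟩ := h
      exact ⟨_, fun u hu hu1 => hΨ W u hu v hv hu1 hv1⟩
    · exact ⟨0, fun u hu hu1 => (h ⟨u, hu, hu1⟩).elim⟩
  choose c hc using this
  choose κ hκ using fun W : Submodule ℝ V => exists_hausdorff_inter_add_unitNormals_eq hdim W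
  set a : ℝ := frameValue o fun b => Ψ.volForm b
  refine ⟨fun W => c W * κ W + a * if W = ⊤ then 1 else 0, fun s hs E hE => ?_⟩
  set P := convexHull ℝ (s : Set V)
  have hfin : (allFaces P).Finite := finite_allFaces s
  have hP : IsCompact P := s.finite_toSet.isCompact_convexHull ℝ
  have hne : P.Nonempty := (Finset.coe_nonempty.2 hs).convexHull
  rw [finsum_faces_eq_finsum_allFaces hfin fun k F =>
      (c (vectorSpan ℝ F) * κ (vectorSpan ℝ F) + a * if vectorSpan ℝ F = ⊤ then 1 else 0) *
        exteriorAngle F P * (hausdorff k (F ∩ E)).toReal,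
    InvFormPair.curvature, integralNormalCycle_eq_finsum hdim hP (convex_convexHull ℝ _) hne hfin hE
      hc, setIntegral_const, smul_eq_mul, Measure.real, toReal_volume_inter_eq_finsum hne,
    mul_comm _ a, mul_finsum_mem, ← finsum_mem_add_distrib hfin]
  refine finsum_mem_congr rfl fun F hF => ?_
  rw [(hκ _ P F E hP hF rfl hE).2]
  ring

end Criterion

/-! ### The alternating sum defining `φ_{kp}` -/

section FaceForms

open Submodule

theorem alternatingMap_sum_apply {R U N ι κ : Type*} [Semiring R] [AddCommMonoid U] [Module R U]
    [AddCommMonoid N] [Module R N] (s : Finset κ) (f : κ → U [⋀^ι]→ₗ[R] N) (v : ι → U) :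
    (∑ i ∈ s, f i) v = ∑ i ∈ s, f i v := by
  have : IsZeroApply (U [⋀^ι]→ₗ[R] N) (ι → U) N := ⟨fun _ => rfl⟩
  have : IsAddApply (U [⋀^ι]→ₗ[R] N) (ι → U) N := ⟨fun _ _ _ => rfl⟩
  exact sum_apply s f v

theorem alternatization_tensorProd_apply {U : Type*} [AddCommGroup U] [Module ℝ U] {q p : ℕ}
    (h : 2 * p ≤ q) (A : Fin p → U →ₗ[ℝ] U →ₗ[ℝ] ℝ) (a : Fin q → U →ₗ[ℝ] ℝ) (v : Fin q → U) :
    MultilinearMap.alternatization (tensorProd h A a) v =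
      ∑ σ : Equiv.Perm (Fin q), ((Equiv.Perm.sign σ : ℤ) : ℝ) *
        ((∏ j : Fin p, A j (v (σ ⟨2 * j, by omega⟩)) (v (σ ⟨2 * j + 1, by omega⟩))) *
          ∏ i : Fin q, if (i : ℕ) < 2 * p then 1 else a i (v (σ i))) := by
  rw [MultilinearMap.alternatization_apply]
  refine Finset.sum_congr rfl fun σ _ => ?_
  rw [Units.smul_def, ← Int.cast_smul_eq_zsmul ℝ, smul_eq_mul]
  rfl

theorem perm_apply_mem_of_mapsTo {ι : Type*} {σ τ : Equiv.Perm ι}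
    {S T : Finset ι} (hσ : ∀ i ∈ T, σ i ∈ S) (hτ : ∀ i ∉ T, τ i ∉ S) {i : ι} (hi : i ∈ T) :
    τ i ∈ S := by
  have hcard : T.card ≤ S.card := Finset.card_le_card_of_injOn σ hσ σ.injective.injOn
  have hmaps : S.map τ.symm.toEmbedding ⊆ T := fun j hj => by
    obtain ⟨s, hs, rfl⟩ := Finset.mem_map.1 hj
    by_contra hsT
    exact hτ _ hsT (by simpa using hs)
  have heq : S.map τ.symm.toEmbedding = T :=
    Finset.eq_of_subset_of_card_le hmaps (by rwa [Finset.card_map])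
  simpa [← heq] using hi

variable {V : Type*} [NormedAddCommGroup V] [InnerProductSpace ℝ V] {m : ℕ}

/-- The summand of `2ᵖ φ_{kp}` that belongs to the permutations `τ` of the frame `b` and `σ` of the
arguments, which have horizontal parts `P (c i)` and vertical parts `Q (c i)`. The curvature form
`Ω(x, y)` is replaced by `R x y`, for an arbitrary quadrilinear form `R`. -/
def phiTerm (R : V →ₗ[ℝ] V →ₗ[ℝ] V →ₗ[ℝ] V →ₗ[ℝ] ℝ) (k p : ℕ) (hp : 2 * p ≤ m)
    (P Q : V →ₗ[ℝ] V) (τ σ : Equiv.Perm (Fin m)) (b c : Fin m → V) : ℝ :=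
  (∏ j : Fin p, R (b (τ ⟨2 * j, by omega⟩)) (b (τ ⟨2 * j + 1, by omega⟩))
    (P (c (σ ⟨2 * j, by omega⟩))) (P (c (σ ⟨2 * j + 1, by omega⟩)))) *
  ∏ i : Fin m, if (i : ℕ) < 2 * p then 1 else
    if (i : ℕ) < k then inner ℝ (b (τ i)) (P (c (σ i))) else inner ℝ (b (τ i)) (Q (c (σ i)))

/-- The value of `2ᵖ φ_{kp}` on the arguments described at `phiTerm`; the power of `2` comes from
antisymmetrizing the `2`-forms `Ω` as well. -/
def phiSum (R : V →ₗ[ℝ] V →ₗ[ℝ] V →ₗ[ℝ] V →ₗ[ℝ] ℝ) (k p : ℕ) (hp : 2 * p ≤ m)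
    (P Q : V →ₗ[ℝ] V) (b c : Fin m → V) : ℝ :=
  ∑ τ : Equiv.Perm (Fin m), ((Equiv.Perm.sign τ : ℤ) : ℝ) *
    ∑ σ : Equiv.Perm (Fin m), ((Equiv.Perm.sign σ : ℤ) : ℝ) * phiTerm R k p hp P Q τ σ b c

variable (R : V →ₗ[ℝ] V →ₗ[ℝ] V →ₗ[ℝ] V →ₗ[ℝ] ℝ) (k p : ℕ) (hp : 2 * p ≤ m) (P Q : V →ₗ[ℝ] V)

theorem exists_alternatingMap_eq_phiSum_left (c : Fin m → V) :
    ∃ f : V [⋀^Fin m]→ₗ[ℝ] ℝ, ∀ b, f b = phiSum R k p hp P Q b c := by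
  refine ⟨∑ σ : Equiv.Perm (Fin m), ((Equiv.Perm.sign σ : ℤ) : ℝ) •
    MultilinearMap.alternatization (tensorProd hp
      (fun j => LinearMap.mk₂ ℝ (fun x y => R x y (P (c (σ ⟨2 * j, by omega⟩)))
        (P (c (σ ⟨2 * j + 1, by omega⟩)))) (by simp) (by simp) (by simp) (by simp))
      (fun i => if (i : ℕ) < k then innerₛₗ ℝ (P (c (σ i))) else innerₛₗ ℝ (Q (c (σ i))))),
    fun b => ?_⟩
  simp only [alternatingMap_sum_apply, AlternatingMap.smul_apply, smul_eq_mul, phiSum,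
    alternatization_tensorProd_apply, Finset.mul_sum]
  rw [Finset.sum_comm]
  refine Finset.sum_congr rfl fun σ _ => Finset.sum_congr rfl fun τ _ => ?_
  rw [mul_left_comm, phiTerm]
  congr 3
  refine Finset.prod_congr rfl fun i _ => ?_
  split_ifs
  · rfl
  · exact real_inner_comm _ _
  · exact real_inner_comm _ _

theorem exists_alternatingMap_eq_phiSum_right (b : Fin m → V) :
    ∃ f : V [⋀^Fin m]→ₗ[ℝ] ℝ, ∀ c, f c = phiSum R k p hp P Q b c := by
  refine ⟨∑ τ : Equiv.Perm (Fin m), ((Equiv.Perm.sign τ : ℤ) : ℝ) •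
    MultilinearMap.alternatization (tensorProd hp
      (fun j => (R (b (τ ⟨2 * j, by omega⟩)) (b (τ ⟨2 * j + 1, by omega⟩))).compl₁₂ P P)
      (fun i => if (i : ℕ) < k then innerₛₗ ℝ (b (τ i)) ∘ₗ P else innerₛₗ ℝ (b (τ i)) ∘ₗ Q)),
    fun c => ?_⟩
  simp only [alternatingMap_sum_apply, AlternatingMap.smul_apply, smul_eq_mul, phiSum,
    alternatization_tensorProd_apply]
  refine Finset.sum_congr rfl fun τ _ => congrArg _ (Finset.sum_congr rfl fun σ _ => ?_)
  rw [phiTerm]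
  congr 2
  refine Finset.prod_congr rfl fun i _ => ?_
  split_ifs <;> rfl

/-- Both `f` on `(b₁, …, b_m)` and `f` on `(c₁, …, c_m)` are values of the top-degree form
`⟨b₀, ·⟩ ∧ f`, so `ε` is the determinant of the change of frame. -/
theorem exists_sign_alternatingMap_succ (b c : OrthonormalBasis (Fin (m + 1)) ℝ V)
    (hbc : b 0 = c 0) :
    ∃ ε : ℝ, ε * ε = 1 ∧ ∀ f : V [⋀^Fin m]→ₗ[ℝ] ℝ,
      f (fun i => c i.succ) = ε * f (fun i => b i.succ) := by
  refine ⟨b.toBasis.det c, ?_, fun f => ?_⟩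
  · rcases b.det_to_matrix_orthonormalBasis_real c with h | h <;> rw [h] <;> norm_num
  set g : V [⋀^Fin (m + 1)]→ₗ[ℝ] ℝ :=
    AlternatingMap.alternatizeUncurryFin ((innerₛₗ ℝ (b 0)).smulRight f)
  have hg (a : OrthonormalBasis (Fin (m + 1)) ℝ V) (ha : a 0 = b 0) :
      g a = f (fun i => a i.succ) := by
    rw [AlternatingMap.alternatizeUncurryFin_apply, Finset.sum_eq_single 0, ← ha]
    · simp only [Fin.val_zero, pow_zero, one_smul, LinearMap.smulRight_apply, innerₛₗ_apply_apply,
        real_inner_self_eq_norm_sq, a.orthonormal.1 0, one_pow]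
      rfl
    · intro i _ hi
      rw [← ha]
      simp [a.orthonormal.2 hi.symm]
    · simp
  rw [← hg b rfl, ← hg c hbc.symm]
  conv_lhs => rw [g.eq_smul_basis_det b.toBasis]
  rw [AlternatingMap.smul_apply, smul_eq_mul, mul_comm, b.coe_toBasis]

theorem phiSum_congr_of_zero_eq (b c : OrthonormalBasis (Fin (m + 1)) ℝ V) (hbc : b 0 = c 0) :
    phiSum R k p hp P Q (fun i => c i.succ) (fun i => c i.succ) =
      phiSum R k p hp P Q (fun i => b i.succ) (fun i => b i.succ) := by
  obtain ⟨ε, hε, h⟩ := exists_sign_alternatingMap_succ b c hbc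
  obtain ⟨f, hf⟩ := exists_alternatingMap_eq_phiSum_left R k p hp P Q fun i => c i.succ
  obtain ⟨g, hg⟩ := exists_alternatingMap_eq_phiSum_right R k p hp P Q fun i => b i.succ
  rw [← hf, h, hf, ← hg, h, hg, ← mul_assoc, hε, one_mul]

theorem map_mem_orthogonal_of_forall_map_eq {W : Submodule ℝ V} {ρ : V ≃ₗᵢ[ℝ] V}
    (hρ : ∀ w ∈ W, ρ w = w) {x : V} (hx : x ∈ Wᗮ) : ρ x ∈ Wᗮ := fun w hw => by
  rw [← hρ w hw, ρ.inner_map_map]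
  exact hx w hw

variable {k p} (W : Submodule ℝ V) [W.HasOrthogonalProjection] (τ σ : Equiv.Perm (Fin m))
  {b c : Fin m → V} {i : Fin m}

theorem phiTerm_eq_zero_of_mem (hpk : 2 * p ≤ k) (hi : k ≤ i) (hb : b (τ i) ∈ W) :
    phiTerm R k p hp W.starProjection.toLinearMap Wᗮ.starProjection.toLinearMap τ σ b c = 0 := by
  rw [phiTerm, Finset.prod_eq_zero (Finset.mem_univ i), mul_zero]
  rw [if_neg (by omega), if_neg (by omega)]
  exact inner_right_of_mem_orthogonal hb (Wᗮ.starProjection_apply_mem _)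

theorem phiTerm_eq_zero_of_mem_orthogonal (hi : i < k) (hc : c (σ i) ∈ Wᗮ) :
    phiTerm R k p hp W.starProjection.toLinearMap Q τ σ b c = 0 := by
  have hproj : W.starProjection.toLinearMap (c (σ i)) = 0 :=
    (starProjection_apply_eq_zero_iff W).2 hc
  rw [phiTerm]
  by_cases hip : (i : ℕ) < 2 * p
  · rw [Finset.prod_eq_zero (Finset.mem_univ (⟨i / 2, by omega⟩ : Fin p)), zero_mul]
    rcases Nat.mod_two_eq_zero_or_one (i : ℕ) with hmod | hmod
    · have hidx : (⟨2 * (i / 2), by omega⟩ : Fin m) = i := Fin.ext (by simp only; omega)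
      simp only [hidx, hproj, map_zero, LinearMap.zero_apply]
    · have hidx : (⟨2 * (i / 2) + 1, by omega⟩ : Fin m) = i := Fin.ext (by simp only; omega)
      simp only [hidx, hproj, map_zero]
  · rw [Finset.prod_eq_zero (Finset.mem_univ i), mul_zero]
    rw [if_neg hip, if_pos hi, hproj, inner_zero_right]

/-- If the term does not vanish, `τ` and `σ` both send `{i | i < k}` into the set of indices of
frame vectors in `W`, where `ρ` is the identity. -/
theorem phiTerm_map (hpk : 2 * p ≤ k) (ρ : V ≃ₗᵢ[ℝ] V) (hρ : ∀ w ∈ W, ρ w = w)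
    (hb : ∀ i, b i ∈ W ∨ b i ∈ Wᗮ) :
    phiTerm R k p hp W.starProjection.toLinearMap Wᗮ.starProjection.toLinearMap τ σ
        (fun i => ρ (b i)) (fun i => ρ (b i)) =
      phiTerm R k p hp W.starProjection.toLinearMap Wᗮ.starProjection.toLinearMap τ σ b b := by
  classical
  have hρ' {x : V} (hx : x ∈ Wᗮ) : ρ x ∈ Wᗮ := map_mem_orthogonal_of_forall_map_eq hρ hx
  by_cases hτ : ∃ i : Fin m, k ≤ i ∧ b (τ i) ∈ W
  · obtain ⟨i, hi, hiW⟩ := hτ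
    rw [phiTerm_eq_zero_of_mem R hp W τ σ hpk hi hiW,
      phiTerm_eq_zero_of_mem R hp W τ σ hpk hi (by rwa [hρ _ hiW])]
  by_cases hσ : ∃ i : Fin m, i < k ∧ b (σ i) ∈ Wᗮ
  · obtain ⟨i, hi, hiW⟩ := hσ
    rw [phiTerm_eq_zero_of_mem_orthogonal R hp _ W τ σ hi hiW,
      phiTerm_eq_zero_of_mem_orthogonal R hp _ W τ σ hi (hρ' hiW)]
  push Not at hτ hσ
  have hσW (i : Fin m) (hi : i < k) : b (σ i) ∈ W := (hb _).resolve_right (hσ i hi)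
  have hτW (i : Fin m) (hi : i < k) : b (τ i) ∈ W := by
    simpa using perm_apply_mem_of_mapsTo (σ := σ) (τ := τ) (S := {i | b i ∈ W})
      (T := {i : Fin m | i < k}) (by simpa using hσW) (by simpa using hτ) (by simpa using hi)
  rw [phiTerm, phiTerm]
  congr 1 <;> refine Finset.prod_congr rfl fun i _ => ?_
  · rw [hρ _ (hτW _ _), hρ _ (hτW _ _), hρ _ (hσW _ _), hρ _ (hσW _ _)] <;> simp only <;> omega
  · split_ifs with hip hik
    · rfl
    · rw [hρ _ (hτW i hik), hρ _ (hσW i hik)]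
    · have hbτ : b (τ i) ∈ Wᗮ := (hb _).resolve_left (hτ i (not_lt.1 hik))
      change inner ℝ (ρ (b (τ i))) (Wᗮ.starProjection _) = inner ℝ (b (τ i)) (Wᗮ.starProjection _)
      rw [← inner_starProjection_left_eq_right, ← inner_starProjection_left_eq_right,
        starProjection_eq_self_iff.2 hbτ, starProjection_eq_self_iff.2 (hρ' hbτ),
        ρ.inner_map_map]

variable [FiniteDimensional ℝ V]

theorem exists_orthonormalBasis_zero_eq {n : ℕ} (hdim : Module.finrank ℝ V = n + 1) {u : V}
    (hu : u ∈ Wᗮ) (hu1 : ‖u‖ = 1) :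
    ∃ b : OrthonormalBasis (Fin (n + 1)) ℝ V, b 0 = u ∧ ∀ i, b i ∈ W ∨ b i ∈ Wᗮ := by
  classical
  have hort : Orthonormal ℝ (Subtype.val : ({⟨u, hu⟩} : Set Wᗮ) → Wᗮ) :=
    ⟨fun x => by rw [x.2]; exact hu1, fun x y hxy => (hxy (Subsingleton.elim x y)).elim⟩
  obtain ⟨t, f, hut, hf⟩ := hort.exists_orthonormalBasis_extension
  set b := ((stdOrthonormalBasis ℝ W).prod f).map W.orthogonalDecomposition.symm
  have hbl (i) : b (Sum.inl i) = stdOrthonormalBasis ℝ W i := by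
    simp [b]
  have hbr (j) : b (Sum.inr j) = f j := by simp [b]
  obtain ⟨e⟩ : Nonempty (Fin _ ⊕ t ≃ Fin (n + 1)) :=
    Fintype.card_eq.1 (by rw [← Module.finrank_eq_card_basis b.toBasis, hdim, Fintype.card_fin])
  set j : t := ⟨⟨u, hu⟩, hut rfl⟩
  refine ⟨b.reindex (e.trans (Equiv.swap (e (Sum.inr j)) 0)), ?_, fun i => ?_⟩
  · rw [OrthonormalBasis.reindex_apply, Equiv.symm_trans_apply, Equiv.symm_swap,
      Equiv.swap_apply_right, e.symm_apply_apply, hbr, hf]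
  · rw [OrthonormalBasis.reindex_apply]
    rcases (e.trans (Equiv.swap (e (Sum.inr j)) 0)).symm i with a | a
    · exact Or.inl (hbl a ▸ (stdOrthonormalBasis ℝ W a).2)
    · exact Or.inr (hbr a ▸ (f a).2)

theorem phiSum_eq_of_mem_orthogonal (hdim : Module.finrank ℝ V = m + 1) (hpk : 2 * p ≤ k)
    (b c : OrthonormalBasis (Fin (m + 1)) ℝ V) (hb : b 0 ∈ Wᗮ) (hc : c 0 ∈ Wᗮ) :
    phiSum R k p hp W.starProjection.toLinearMap Wᗮ.starProjection.toLinearMap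
        (fun i => b i.succ) (fun i => b i.succ) =
      phiSum R k p hp W.starProjection.toLinearMap Wᗮ.starProjection.toLinearMap
        (fun i => c i.succ) (fun i => c i.succ) := by
  obtain ⟨a, ha, haW⟩ := exists_orthonormalBasis_zero_eq W hdim hb (b.orthonormal.1 0)
  set ρ : V ≃ₗᵢ[ℝ] V := (ℝ ∙ (b 0 - c 0))ᗮ.reflection
  have hρ (w : V) (hw : w ∈ W) : ρ w = w := reflection_mem_subspace_eq_self
    (mem_orthogonal_singleton_iff_inner_right.2 (inner_left_of_mem_orthogonal hw (sub_mem hb hc)))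
  have hρa : (a.map ρ) 0 = c 0 := by
    rw [OrthonormalBasis.map_apply, ha, reflection_sub]
    rw [b.orthonormal.1, c.orthonormal.1]
  rw [phiSum_congr_of_zero_eq R k p hp _ _ a b ha, phiSum_congr_of_zero_eq R k p hp _ _ _ c hρa]
  refine Finset.sum_congr rfl fun τ _ => congrArg _ (Finset.sum_congr rfl fun σ _ => ?_)
  simp only [OrthonormalBasis.map_apply]
  rw [phiTerm_map R hp W τ σ hpk ρ hρ fun i => haW i.succ]

end FaceForms

/-! ### The forms `φ_{kp}` on horizontal and vertical lifts -/

section Bundle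

variable {𝕜 EB F HB B : Type*} [NontriviallyNormedField 𝕜] [NormedAddCommGroup EB]
  [NormedSpace 𝕜 EB] [NormedAddCommGroup F] [NormedSpace 𝕜 F] [TopologicalSpace HB]
  {I : ModelWithCorners 𝕜 EB HB} [TopologicalSpace B] [ChartedSpace HB B] {Z : B → Type*}
  [TopologicalSpace (Bundle.TotalSpace F Z)] [∀ b, TopologicalSpace (Z b)] [FiberBundle F Z]

theorem writtenInExtChartAt_totalSpace_proj {ξ : Bundle.TotalSpace F Z} {z : EB × F}
    (hz : z ∈ (extChartAt (I.prod 𝓘(𝕜, F)) ξ).target) :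
    writtenInExtChartAt (I.prod 𝓘(𝕜, F)) I ξ Bundle.TotalSpace.proj z = z.1 := by
  rw [FiberBundle.extChartAt_target] at hz
  rw [writtenInExtChartAt, FiberBundle.extChartAt]
  exact (congrArg (extChartAt I ξ.proj) (Bundle.Trivialization.proj_symm_apply' _ hz.1.2)).trans
    ((extChartAt I ξ.proj).right_inv hz.1.1)

theorem hasMFDerivAt_totalSpace_proj (ξ : Bundle.TotalSpace F Z) :
    HasMFDerivAt (I.prod 𝓘(𝕜, F)) I (Bundle.TotalSpace.proj : Bundle.TotalSpace F Z → B) ξ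
      (ContinuousLinearMap.fst 𝕜 EB F) := by
  refine ⟨(FiberBundle.continuous_proj F Z).continuousAt, ?_⟩
  refine hasFDerivWithinAt_fst.congr_of_eventuallyEq ?_
    (writtenInExtChartAt_totalSpace_proj (mem_extChartAt_target ξ))
  filter_upwards [extChartAt_target_mem_nhdsWithin ξ]
    with z using writtenInExtChartAt_totalSpace_proj

end Bundle

section Lift

variable {E : Type*} [NormedAddCommGroup E] [NormedSpace ℝ E]
  {M : Type*} [TopologicalSpace M] [ChartedSpace E M] [IsManifold 𝓘(ℝ, E) ∞ M]
  [Bundle.RiemannianBundle (fun x : M => TangentSpace 𝓘(ℝ, E) x)]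

theorem projDeriv_liftMap (x : M) (u : TangentSpace 𝓘(ℝ, E) x)
    (v : TangentSpace 𝓘(ℝ, E) x × TangentSpace 𝓘(ℝ, E) x) :
    projDeriv (⟨x, u⟩ : TangentBundle 𝓘(ℝ, E) M) (liftMap x u v) = v.1 := by
  rw [projDeriv, (hasMFDerivAt_totalSpace_proj _).mfderiv]
  rfl

theorem connectionMap_liftMap (x : M) (u : TangentSpace 𝓘(ℝ, E) x)
    (v : TangentSpace 𝓘(ℝ, E) x × TangentSpace 𝓘(ℝ, E) x) :
    connectionMap (⟨x, u⟩ : TangentBundle 𝓘(ℝ, E) M) (liftMap x u v) = v.2 :=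
  sub_add_cancel (G := E) _ _

theorem curvatureTensor_add (g : E → E →L[ℝ] E →L[ℝ] ℝ) (z u v w w' : E) :
    curvatureTensor g z u v (w + w') = curvatureTensor g z u v w + curvatureTensor g z u v w' := by
  simp only [curvatureTensor, map_add]
  abel

theorem curvatureTensor_smul (g : E → E →L[ℝ] E →L[ℝ] ℝ) (z u v w : E) (t : ℝ) :
    curvatureTensor g z u v (t • w) = t • curvatureTensor g z u v w := by
  simp only [curvatureTensor, map_smul, smul_sub, smul_add]

theorem curvatureForm_apply (x : M) (b c v w : TangentSpace 𝓘(ℝ, E) x) :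
    curvatureForm x b c v w = innerₛₗ ℝ b (curvatureTensor (E := E) (chartMetric x)
      (extChartAt 𝓘(ℝ, E) x x) v w c : TangentSpace 𝓘(ℝ, E) x) := rfl

/-- The curvature form `Ω(b, c)(v, w)` as a quadrilinear form. -/
def curvatureQuadrilinear (x : M) :
    TangentSpace 𝓘(ℝ, E) x →ₗ[ℝ] TangentSpace 𝓘(ℝ, E) x →ₗ[ℝ]
      TangentSpace 𝓘(ℝ, E) x →ₗ[ℝ] TangentSpace 𝓘(ℝ, E) x →ₗ[ℝ] ℝ :=
  LinearMap.mk₂ ℝ (curvatureForm x)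
    (fun b b' c => LinearMap.ext₂ fun v w => by
      rw [LinearMap.add_apply, LinearMap.add_apply, curvatureForm_apply, map_add]
      rfl)
    (fun t b c => LinearMap.ext₂ fun v w => by
      rw [LinearMap.smul_apply, LinearMap.smul_apply, curvatureForm_apply, map_smul]
      rfl)
    (fun b c c' => LinearMap.ext₂ fun v w => by
      rw [LinearMap.add_apply, LinearMap.add_apply, curvatureForm_apply]
      exact (congrArg (innerₛₗ ℝ b) (curvatureTensor_add (E := E) (chartMetric x)
        (extChartAt 𝓘(ℝ, E) x x) v w c c')).trans (map_add (innerₛₗ ℝ b) _ _))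
    (fun t b c => LinearMap.ext₂ fun v w => by
      rw [LinearMap.smul_apply, LinearMap.smul_apply, curvatureForm_apply]
      exact (congrArg (innerₛₗ ℝ b) (curvatureTensor_smul (E := E) (chartMetric x)
        (extChartAt 𝓘(ℝ, E) x x) v w c t)).trans (map_smul (innerₛₗ ℝ b) _ _))

theorem phiFrame_liftMap {m : ℕ} (k p : ℕ) (hp : 2 * p ≤ m) (x : M) (u : TangentSpace 𝓘(ℝ, E) x)
    (b : OrthonormalBasis (Fin (m + 1)) ℝ (TangentSpace 𝓘(ℝ, E) x))
    (P Q : TangentSpace 𝓘(ℝ, E) x →ₗ[ℝ] TangentSpace 𝓘(ℝ, E) x)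
    (c : Fin m → TangentSpace 𝓘(ℝ, E) x) :
    phiFrame k p hp (⟨x, u⟩ : TangentBundle 𝓘(ℝ, E) M) b
        (fun i => liftMap x u (P (c i), Q (c i))) =
      ((2 : ℝ) ^ p)⁻¹ *
        phiSum (curvatureQuadrilinear x) k p hp P Q (fun i => b i.succ) c := by
  rw [phiFrame, alternatingMap_sum_apply, phiSum, Finset.mul_sum]
  refine Finset.sum_congr rfl fun τ _ => ?_
  rw [AlternatingMap.smul_apply, wedge, AlternatingMap.smul_apply, smul_eq_mul, smul_eq_mul,
    alternatization_tensorProd_apply, mul_left_comm]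
  congr 2
  refine Finset.sum_congr rfl fun σ _ => congrArg _ ?_
  rw [phiTerm]
  congr 1 <;> refine Finset.prod_congr rfl fun i _ => ?_
  · rw [bigOmega, LinearMap.compl₁₂_apply, projDeriv_liftMap, projDeriv_liftMap]
    rfl
  · split_ifs
    · rfl
    · rw [theta, LinearMap.comp_apply, projDeriv_liftMap]
      rfl
    · rw [omegaZero, LinearMap.comp_apply, connectionMap_liftMap]
      rfl

end Lift

section CurvatureMeasure

theorem frameSign_mul_self {V : Type*} [NormedAddCommGroup V] [InnerProductSpace ℝ V] {m : ℕ}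
    (o : Orientation ℝ V (Fin (m + 1))) (b : OrthonormalBasis (Fin (m + 1)) ℝ V) :
    frameSign o b * frameSign o b = 1 := by
  unfold frameSign
  split_ifs <;> norm_num

/-- Both uses of `adaptedFrameValue` choose the same frame, so the orientation signs cancel. -/
theorem exists_adaptedFrameValue_smul_apply_eq {V U : Type*} [NormedAddCommGroup V]
    [InnerProductSpace ℝ V] [AddCommGroup U] [Module ℝ U] {m : ℕ}
    (o : Orientation ℝ V (Fin (m + 1))) (b : OrthonormalBasis (Fin (m + 1)) ℝ V) (C : ℝ)
    (Φ : OrthonormalBasis (Fin (m + 1)) ℝ V → U [⋀^Fin m]→ₗ[ℝ] ℝ)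
    (v : OrthonormalBasis (Fin (m + 1)) ℝ V → Fin m → U) :
    ∃ c : OrthonormalBasis (Fin (m + 1)) ℝ V, c 0 = b 0 ∧
      adaptedFrameValue o (b 0) (fun a => (C • adaptedFrameValue o (b 0) Φ) (v a)) =
        C * Φ c (v c) := by
  have h : ∃ c : OrthonormalBasis (Fin (m + 1)) ℝ V, c 0 = b 0 := ⟨b, rfl⟩
  refine ⟨h.choose, h.choose_spec, ?_⟩
  simp only [adaptedFrameValue, dif_pos h]
  rw [AlternatingMap.smul_apply, AlternatingMap.smul_apply, smul_comm,
    smul_smul (frameSign o _), frameSign_mul_self, one_smul, smul_eq_mul]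

variable {E : Type*} [NormedAddCommGroup E] [NormedSpace ℝ E] [FiniteDimensional ℝ E]
  {M : Type*} [TopologicalSpace M] [ChartedSpace E M] [IsManifold 𝓘(ℝ, E) ∞ M]
  [Bundle.RiemannianBundle (fun x : M => TangentSpace 𝓘(ℝ, E) x)] {m : ℕ}
  (o : ∀ x : M, Orientation ℝ (TangentSpace 𝓘(ℝ, E) x) (Fin (m + 1))) {k p : ℕ} (hp : 2 * p ≤ k)
  {x : M} (W : Submodule ℝ (TangentSpace 𝓘(ℝ, E) x))

theorem faceValue_curvC_transfer_of_lt (hk : k < m + 1)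
    (b : OrthonormalBasis (Fin (m + 1)) ℝ (TangentSpace 𝓘(ℝ, E) x)) :
    faceValue (o x) ((curvC (E := E) o k p hp).transfer x).sphereForm W (b 0) =
      ballVol k / (Real.pi ^ k * (m + 1 - k).factorial * ballVol (m + 1 - k)) *
        (((2 : ℝ) ^ p)⁻¹ * phiSum (curvatureQuadrilinear x) k p (by omega)
          W.starProjection.toLinearMap Wᗮ.starProjection.toLinearMap
          (fun i => b i.succ) (fun i => b i.succ)) := by
  set C : ℝ := ballVol k / (Real.pi ^ k * (m + 1 - k).factorial * ballVol (m + 1 - k))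
  obtain ⟨c, hc, h⟩ := exists_adaptedFrameValue_smul_apply_eq (o x) b C
    (phiFrame k p (by omega) (⟨x, b 0⟩ : TangentBundle 𝓘(ℝ, E) M))
    (fun a i => liftMap x (b 0) (W.starProjection (a i.succ), Wᗮ.starProjection (a i.succ)))
  have hform : (curvC (E := E) o k p hp).sphereForm ⟨x, b 0⟩ =
      C • adaptedFrameValue (o x) (b 0) (phiFrame k p (by omega) ⟨x, b 0⟩) := dif_pos hk
  rw [← hform] at h
  rw [← phiSum_congr_of_zero_eq _ k p _ _ _ b c hc.symm, ← phiFrame_liftMap k p _ x (b 0) c]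
  exact h

theorem faceValue_curvC_transfer_of_le (hk : m + 1 ≤ k) (u : TangentSpace 𝓘(ℝ, E) x) :
    faceValue (o x) ((curvC (E := E) o k p hp).transfer x).sphereForm W u = 0 := by
  have hform : (curvC (E := E) o k p hp).sphereForm ⟨x, u⟩ = 0 := dif_neg hk.not_gt
  simp only [faceValue, adaptedFrameValue, FormPair.transfer, hform]
  split_ifs
  · exact smul_zero _
  · rfl

theorem faceValue_curvC_transfer_eq (hdim : Module.finrank ℝ E = m + 1)
    {u v : TangentSpace 𝓘(ℝ, E) x} (hu : u ∈ Wᗮ) (hv : v ∈ Wᗮ) (hu1 : ‖u‖ = 1) (hv1 : ‖v‖ = 1) :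
    faceValue (o x) ((curvC (E := E) o k p hp).transfer x).sphereForm W u =
      faceValue (o x) ((curvC (E := E) o k p hp).transfer x).sphereForm W v := by
  rcases lt_or_ge k (m + 1) with hk | hk
  · obtain ⟨b, rfl, -⟩ := exists_orthonormalBasis_zero_eq W hdim hu hu1
    obtain ⟨c, rfl, -⟩ := exists_orthonormalBasis_zero_eq W hdim hv hv1
    rw [faceValue_curvC_transfer_of_lt o hp W hk b, faceValue_curvC_transfer_of_lt o hp W hk c,
      phiSum_eq_of_mem_orthogonal _ _ W hdim hp b c hu hv]
  · rw [faceValue_curvC_transfer_of_le o hp W hk, faceValue_curvC_transfer_of_le o hp W hk]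

end CurvatureMeasure

end RiemCurv

end

theorem mainTheorem12 {E : Type*} [NormedAddCommGroup E] [NormedSpace ℝ E] [FiniteDimensional ℝ E]
    {M : Type*} [TopologicalSpace M] [ChartedSpace E M] [IsManifold 𝓘(ℝ, E) ∞ M]
    [Bundle.RiemannianBundle (fun x : M => TangentSpace 𝓘(ℝ, E) x)]
    [IsContMDiffRiemannianBundle 𝓘(ℝ, E) ∞ E (fun x : M => TangentSpace 𝓘(ℝ, E) x)]
    (m : ℕ) (hdim : Module.finrank ℝ E = m + 1)
    (o : ∀ x : M, Orientation ℝ (TangentSpace 𝓘(ℝ, E) x) (Fin (m + 1)))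
    (k p : ℕ) (hp : 2 * p ≤ k) :
    (RiemCurv.curvC (E := E) o k p hp).IsAngular o := fun _ =>
  RiemCurv.isAngular_of_faceValue_eq hdim _ fun W _ hu _ hv hu1 hv1 =>
    RiemCurv.faceValue_curvC_transfer_eq o hp W hdim hu hv hu1 hv1
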